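/- Let $k$ be a field and let $n\ge 1$ be an integer. For $X\in \mathcal M_n(k)\otimes \mathcal M_n(k)$ let $X^{12},X^{13},X^{23}\in \mathcal M_n(k)^{\otimes 3}$ be the images of $X$ under $a\otimes b\mapsto a\otimes b\otimes 1,\ a\otimes 1\otimes b,\ 1\otimes a\otimes b$, and let the tensor length $l(X)$ be the least $m$ such that $X$ is a sum of $m$ pure tensors. Let $\mathrm{Pent}_n$ be the set of invertible $R\in \mathcal M_n(k)\otimes \mathcal M_n(k)$ with $l(R)=n$ that satisfy the pentagon equation $R^{12}R^{13}R^{23}=R^{23}R^{12}$. The group $GL_n(k)$ acts on $\mathrm{Pent}_n$ by $$(u,R)\mapsto (u\otimes u)R(u\otimes u)^{-1}.$$ For $R=\sum R^1\otimes R^2\in \mathrm{Pent}_n$ with inverse $R^{-1}=\sum U^1\otimes U^2$, let $$P(n,R)=\Bigl\{\sum \langle\omega,R^2\rangle R^1 \;\Big|\; \omega\in \mathcal M_n(k)^*\Bigr\}$$ be the space of left coefficients of $R$. It is a subalgebra of $\mathcal M_n(k)$, and a Hopf algebra with comultiplication $\Delta(x)=R^{-1}(I_n\otimes x)R$, with counit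 determined by $\varepsilon\bigl(\sum\langle\omega,R^2\rangle R^1\bigr)=\langle\omega,I_n\rangle$, and with antipode determined by $S\bigl(\sum\langle\omega,R^2\rangle R^1\bigr)=\sum\langle\omega,U^2\rangle U^1$. **Classification Theorem.** For every $R\in\mathrm{Pent}_n$ the Hopf algebra $P(n,R)$ has dimension $n$, and $R\mapsto P(n,R)$ induces a well-defined one-to-one correspondence between the set of orbits of the above action of $GL_n(k)$ on $\mathrm{Pent}_n$ and the set of isomorphism types of $n$-dimensional Hopf algebras over $k$. In particular, every $n$-dimensional Hopf algebra over $k$ is isomorphic to $P(n,R)$ for some $R\in\mathrm{Pent}_n$. -/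

import Mathlib

open scoped TensorProduct

namespace PentagonHopf

noncomputable section

section Basic

variable {k A B : Type*} [Field k] [Ring A] [Algebra k A] [Ring B] [Algebra k B]

/-- `X ↦ X^{12}`, that is `a ⊗ b ↦ a ⊗ b ⊗ 1`. -/
def leg12 : A ⊗[k] A →ₐ[k] A ⊗[k] (A ⊗[k] A) :=
  Algebra.TensorProduct.map (AlgHom.id k A) Algebra.TensorProduct.includeLeft

/-- `X ↦ X^{13}`, that is `a ⊗ b ↦ a ⊗ 1 ⊗ b`. -/
def leg13 : A ⊗[k] A →ₐ[k] A ⊗[k] (A ⊗[k] A) :=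
  Algebra.TensorProduct.map (AlgHom.id k A) Algebra.TensorProduct.includeRight

/-- `X ↦ X^{23}`, that is `a ⊗ b ↦ 1 ⊗ a ⊗ b`. -/
def leg23 : A ⊗[k] A →ₐ[k] A ⊗[k] (A ⊗[k] A) :=
  Algebra.TensorProduct.includeRight

@[simp] theorem leg12_tmul (a b : A) :
    leg12 (a ⊗ₜ[k] b) = a ⊗ₜ[k] (b ⊗ₜ[k] (1 : A)) := by simp [leg12]

@[simp] theorem leg13_tmul (a b : A) :
    leg13 (a ⊗ₜ[k] b) = a ⊗ₜ[k] ((1 : A) ⊗ₜ[k] b) := by simp [leg13]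

@[simp] theorem leg23_apply (X : A ⊗[k] A) : leg23 X = (1 : A) ⊗ₜ[k] X := rfl

/-- The pentagon equation `R^{12} R^{13} R^{23} = R^{23} R^{12}`. -/
def IsPentagon (R : A ⊗[k] A) : Prop :=
  leg12 R * leg13 R * leg23 R = leg23 R * leg12 R

/-- The tensor length: the least `m` such that `R` is a sum of `m` pure tensors. -/
def tensorLength (R : A ⊗[k] A) : ℕ :=
  sInf {m : ℕ | ∃ a b : Fin m → A, R = ∑ i, a i ⊗ₜ[k] b i}

/-- `∑ R¹ ⊗ R² ↦ ∑ ⟨ω, R²⟩ R¹`. -/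
def sliceL (ω : Module.Dual k B) : A ⊗[k] B →ₗ[k] A :=
  (TensorProduct.rid k A).toLinearMap ∘ₗ ω.lTensor A

/-- `∑ R¹ ⊗ R² ↦ ∑ ⟨ω, R¹⟩ R²`. -/
def sliceR (ω : Module.Dual k A) : A ⊗[k] B →ₗ[k] B :=
  (TensorProduct.lid k B).toLinearMap ∘ₗ ω.rTensor B

@[simp] theorem sliceL_tmul (ω : Module.Dual k B) (a : A) (b : B) :
    sliceL ω (a ⊗ₜ[k] b) = ω b • a := by simp [sliceL]

@[simp] theorem sliceR_tmul (ω : Module.Dual k A) (a : A) (b : B) :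
    sliceR ω (a ⊗ₜ[k] b) = ω a • b := by simp [sliceR]

/-- `ω ↦ ∑ ⟨ω, R²⟩ R¹` as a linear map on the dual space. -/
def sliceLMap (R : A ⊗[k] A) : Module.Dual k A →ₗ[k] A where
  toFun ω := sliceL ω R
  map_add' x y := by simp [sliceL, LinearMap.lTensor_add]
  map_smul' c x := by simp [sliceL, LinearMap.lTensor_smul]

/-- `ω ↦ ∑ ⟨ω, R¹⟩ R²` as a linear map on the dual space. -/
def sliceRMap (R : A ⊗[k] A) : Module.Dual k A →ₗ[k] A where
  toFun ω := sliceR ω R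
  map_add' x y := by simp [sliceR, LinearMap.rTensor_add]
  map_smul' c x := by simp [sliceR, LinearMap.rTensor_smul]

/-- The space `R_(l)` of left coefficients of `R`. -/
def leftCoeff (R : A ⊗[k] A) : Submodule k A := LinearMap.range (sliceLMap R)

/-- The space `R_(r)` of right coefficients of `R`. -/
def rightCoeff (R : A ⊗[k] A) : Submodule k A := LinearMap.range (sliceRMap R)

theorem sliceL_mem (R : A ⊗[k] A) (ω : Module.Dual k A) : sliceL ω R ∈ leftCoeff R := ⟨ω, rfl⟩

theorem sliceR_mem (R : A ⊗[k] A) (ω : Module.Dual k A) : sliceR ω R ∈ rightCoeff R := ⟨ω, rfl⟩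

theorem slice_comm (X : A ⊗[k] A) (s t : Module.Dual k A) :
    s (sliceL t X) = t (sliceR s X) := by
  induction X with
  | zero => simp
  | add x y hx hy => simp [hx, hy]
  | tmul a b => simp [mul_comm]

theorem eq_sum_sliceL {ι : Type*} [Fintype ι] (e : Module.Basis ι k B) (X : A ⊗[k] B) :
    X = ∑ i, sliceL (e.coord i) X ⊗ₜ[k] e i := by
  induction X with
  | zero => simp
  | add x y hx hy =>
    simp only [map_add, TensorProduct.add_tmul, Finset.sum_add_distrib]
    rw [← hx, ← hy]
  | tmul a b =>
    conv_lhs => rw [← e.sum_repr b]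
    rw [TensorProduct.tmul_sum]
    simp [TensorProduct.smul_tmul]

theorem ext_sliceL [FiniteDimensional k B] {X Y : A ⊗[k] B}
    (h : ∀ ω : Module.Dual k B, sliceL ω X = sliceL ω Y) : X = Y := by
  rw [eq_sum_sliceL (Module.finBasis k B) X, eq_sum_sliceL (Module.finBasis k B) Y]
  simp [h]

/-- The linear form `λ ⊗ μ`. -/
def dualMul (s t : Module.Dual k A) : Module.Dual k (A ⊗[k] A) :=
  LinearMap.mul' k k ∘ₗ TensorProduct.map s t

@[simp] theorem dualMul_tmul (s t : Module.Dual k A) (a b : A) :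
    dualMul s t (a ⊗ₜ[k] b) = s a * t b := by simp [dualMul]

theorem sliceL_mul_sliceL (s t : Module.Dual k A) (X Y : A ⊗[k] A) :
    sliceL s X * sliceL t Y = sliceL (dualMul s t) (leg12 X * leg13 Y) := by
  induction X with
  | zero => simp
  | add x y hx hy => simp [add_mul, hx, hy]
  | tmul a b =>
    induction Y with
    | zero => simp
    | add x y hx hy => rw [map_add, map_add, mul_add, mul_add, map_add, hx, hy]
    | tmul c d => simp [smul_smul, mul_comm]

theorem sliceR_mul_sliceR (s t : Module.Dual k A) (X Y : A ⊗[k] A) :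
    sliceR s X * sliceR t Y =
      sliceR (dualMul s t) ((Algebra.TensorProduct.assoc k k k A A A).symm
        (leg13 X * leg23 Y)) := by
  induction X with
  | zero => simp
  | add x y hx hy => simp only [map_add, add_mul, hx, hy]
  | tmul a b =>
    induction Y with
    | zero => simp
    | add x y hx hy => rw [map_add, map_add, mul_add, mul_add, map_add, map_add, hx, hy]
    | tmul c d => simp [smul_smul, mul_comm]

/-- `b ↦ Z (b ⊗ 1) W`. -/
def conjL (Z W : A ⊗[k] A) : A →ₗ[k] A ⊗[k] A :=
  LinearMap.mulRight k W ∘ₗ LinearMap.mulLeft k Z ∘ₗ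
    (Algebra.TensorProduct.includeLeft : A →ₐ[k] A ⊗[k] A).toLinearMap

/-- `b ↦ Z (1 ⊗ b) W`. -/
def conjR (Z W : A ⊗[k] A) : A →ₗ[k] A ⊗[k] A :=
  LinearMap.mulRight k W ∘ₗ LinearMap.mulLeft k Z ∘ₗ
    (Algebra.TensorProduct.includeRight : A →ₐ[k] A ⊗[k] A).toLinearMap

@[simp] theorem conjL_apply (Z W : A ⊗[k] A) (b : A) :
    conjL Z W b = Z * (b ⊗ₜ[k] 1) * W := by simp [conjL]

@[simp] theorem conjR_apply (Z W : A ⊗[k] A) (b : A) :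
    conjR Z W b = Z * (1 ⊗ₜ[k] b) * W := by simp [conjR]

theorem leg23_leg12_leg23 (Z X W : A ⊗[k] A) :
    leg23 Z * leg12 X * leg23 W = (conjL Z W).lTensor A X := by
  induction X with
  | zero => simp
  | add x y hx hy =>
    rw [map_add, map_add, mul_add, add_mul, hx, hy]
  | tmul a b => simp

theorem leg12_leg23_leg12 (Z X W : A ⊗[k] A) :
    (Algebra.TensorProduct.assoc k k k A A A).symm (leg12 Z * leg23 X * leg12 W) =
      (conjR Z W).rTensor A X := by
  have h12 : ∀ Z : A ⊗[k] A,
      (Algebra.TensorProduct.assoc k k k A A A).symm (leg12 Z) = Z ⊗ₜ[k] (1 : A) := by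
    intro Z
    induction Z with
    | zero => simp
    | add x y hx hy => simp only [map_add, hx, hy, TensorProduct.add_tmul]
    | tmul a b => simp
  rw [map_mul, map_mul, h12, h12]
  induction X with
  | zero => simp
  | add x y hx hy =>
    rw [map_add, map_add, mul_add, add_mul, map_add, hx, hy]
  | tmul a b => simp

theorem sliceL_lTensor {C : Type*} [Ring C] [Algebra k C] (f : A →ₗ[k] C)
    (ω : Module.Dual k C) (X : B ⊗[k] A) :
    sliceL ω (f.lTensor B X) = sliceL (ω ∘ₗ f) X := by
  induction X with
  | zero => simp
  | add x y hx hy => simp only [map_add, hx, hy]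
  | tmul a b => simp

theorem sliceR_rTensor {C : Type*} [Ring C] [Algebra k C] (f : A →ₗ[k] C)
    (ω : Module.Dual k C) (X : A ⊗[k] B) :
    sliceR ω (f.rTensor B X) = sliceR (ω ∘ₗ f) X := by
  induction X with
  | zero => simp
  | add x y hx hy => simp only [map_add, hx, hy]
  | tmul a b => simp

theorem eq_sum_sliceR {ι : Type*} [Fintype ι] (e : Module.Basis ι k A) (X : A ⊗[k] B) :
    X = ∑ i, e i ⊗ₜ[k] sliceR (e.coord i) X := by
  induction X with
  | zero => simp
  | add x y hx hy =>
    simp only [map_add, TensorProduct.tmul_add, Finset.sum_add_distrib]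
    rw [← hx, ← hy]
  | tmul a b =>
    conv_lhs => rw [← e.sum_repr a]
    rw [TensorProduct.sum_tmul]
    simp [TensorProduct.smul_tmul]

theorem sliceL_mul_tmul (ω : Module.Dual k A) (X : A ⊗[k] A) (c d : A) :
    sliceL ω (X * (c ⊗ₜ[k] d)) = sliceL (ω ∘ₗ LinearMap.mulRight k d) X * c := by
  induction X with
  | zero => simp
  | add x y hx hy => simp only [add_mul, map_add, hx, hy]
  | tmul a b => simp

theorem sliceR_mul_tmul (ω : Module.Dual k A) (X : A ⊗[k] A) (c d : A) :
    sliceR ω (X * (c ⊗ₜ[k] d)) = sliceR (ω ∘ₗ LinearMap.mulRight k c) X * d := by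
  induction X with
  | zero => simp
  | add x y hx hy => simp only [add_mul, map_add, hx, hy]
  | tmul a b => simp

theorem exists_dual_one (h : (1 : A) ≠ 0) : ∃ ω : Module.Dual k A, ω 1 = 1 := by
  by_contra hcon
  push Not at hcon
  refine h ((Module.forall_dual_apply_eq_zero_iff k (1 : A)).1 fun f => ?_)
  by_contra hf
  exact hcon ((f 1)⁻¹ • f) (by simp [hf])

theorem sliceL_rTensor {C : Type*} [Ring C] [Algebra k C] (f : A →ₗ[k] C)
    (ω : Module.Dual k B) (X : A ⊗[k] B) :
    sliceL ω (f.rTensor B X) = f (sliceL ω X) := by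
  induction X with
  | zero => simp
  | add x y hx hy => simp only [map_add, hx, hy]
  | tmul a b => simp

theorem mem_of_mul_mem {E : Type*} [Ring E] [Algebra k E] [FiniteDimensional k E]
    (N : Submodule k E) (u : Eˣ) (hu : (u : E) ∈ N) (h : ∀ x ∈ N, (u : E) * x ∈ N) :
    (1 : E) ∈ N ∧ ((u⁻¹ : Eˣ) : E) ∈ N := by
  have hinj : Function.Injective ((LinearMap.mulLeft k (u : E)).restrict h) := by
    intro x y hxy
    have h2 : (u : E) * x = (u : E) * y := congrArg Subtype.val hxy
    exact Subtype.ext (u.isUnit.mul_left_cancel h2)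
  have hsurj := LinearMap.injective_iff_surjective.1 hinj
  have key : ∀ y ∈ N, ((u⁻¹ : Eˣ) : E) * y ∈ N := by
    intro y hy
    obtain ⟨x, hx⟩ := hsurj ⟨y, hy⟩
    have hx' : (u : E) * x = y := congrArg Subtype.val hx
    rw [← hx', Units.inv_mul_cancel_left]
    exact x.2
  have h1 : (1 : E) ∈ N := by simpa using key _ hu
  exact ⟨h1, by simpa using key _ h1⟩

end Basic

/-- Invertible solutions of the pentagon equation in `A ⊗ A`. -/
structure PentagonSolution (k A : Type*) [Field k] [Ring A] [Algebra k A] where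
  /-- the underlying tensor -/
  val : A ⊗[k] A
  isUnit : IsUnit val
  pentagon : IsPentagon val

namespace PentagonSolution

variable {k A : Type*} [Field k] [Ring A] [Algebra k A]

@[ext] theorem ext {R S : PentagonSolution k A} (h : R.val = S.val) : R = S := by
  cases R; cases S; cases h; rfl

/-- `R⁻¹`. -/
def inv (R : PentagonSolution k A) : A ⊗[k] A := ((R.isUnit.unit⁻¹ : (A ⊗[k] A)ˣ) : A ⊗[k] A)

theorem val_mul_inv (R : PentagonSolution k A) : R.val * R.inv = 1 := R.isUnit.mul_val_inv

theorem inv_mul_val (R : PentagonSolution k A) : R.inv * R.val = 1 := R.isUnit.val_inv_mul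

theorem leg12_mul_leg13 (R : PentagonSolution k A) :
    leg12 R.val * leg13 R.val = leg23 R.val * leg12 R.val * leg23 R.inv := by
  rw [← R.pentagon, mul_assoc _ (leg23 R.val), ← map_mul, R.val_mul_inv, map_one, mul_one]

theorem leg13_mul_leg23 (R : PentagonSolution k A) :
    leg13 R.val * leg23 R.val = leg12 R.inv * leg23 R.val * leg12 R.val := by
  rw [mul_assoc (leg12 R.inv), ← R.pentagon, mul_assoc, ← mul_assoc (leg12 R.inv), ← map_mul,
    R.inv_mul_val, map_one, one_mul]

/-- The algebra map `Δ_r : A → A ⊗ A`, `x ↦ R⁻¹ (1 ⊗ x) R`. -/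
def comulA (R : PentagonSolution k A) : A →ₐ[k] A ⊗[k] A :=
  AlgHom.ofLinearMap (conjR R.inv R.val) (by simp [← Algebra.TensorProduct.one_def, R.inv_mul_val])
    (by
      intro x y
      simp only [conjR_apply]
      have : (1 : A) ⊗ₜ[k] (x * y) = (1 ⊗ₜ[k] x) * (R.val * R.inv) * (1 ⊗ₜ[k] y) := by
        simp [R.val_mul_inv]
      rw [this]
      simp only [mul_assoc])

theorem comulA_apply (R : PentagonSolution k A) (x : A) :
    R.comulA x = R.inv * (1 ⊗ₜ[k] x) * R.val := by simp [comulA]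

theorem mul_mem_leftCoeff (R : PentagonSolution k A) {x y : A} (hx : x ∈ leftCoeff R.val)
    (hy : y ∈ leftCoeff R.val) : x * y ∈ leftCoeff R.val := by
  obtain ⟨s, rfl⟩ := hx
  obtain ⟨t, rfl⟩ := hy
  change sliceL s R.val * sliceL t R.val ∈ _
  rw [sliceL_mul_sliceL, leg12_mul_leg13, leg23_leg12_leg23, sliceL_lTensor]
  exact sliceL_mem _ _

theorem mul_mem_rightCoeff (R : PentagonSolution k A) {x y : A} (hx : x ∈ rightCoeff R.val)
    (hy : y ∈ rightCoeff R.val) : x * y ∈ rightCoeff R.val := by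
  obtain ⟨s, rfl⟩ := hx
  obtain ⟨t, rfl⟩ := hy
  change sliceR s R.val * sliceR t R.val ∈ _
  rw [sliceR_mul_sliceR, leg13_mul_leg23, leg12_leg23_leg12, sliceR_rTensor]
  exact sliceR_mem _ _

theorem comulA_sliceL (R : PentagonSolution k A) {ι : Type*} [Fintype ι]
    (e : Module.Basis ι k A) (ω : Module.Dual k A) :
    R.comulA (sliceL ω R.val) = ∑ i, ∑ j, ω (e i * e j) •
      (sliceL (e.coord i) R.val ⊗ₜ[k] sliceL (e.coord j) R.val) := by
  have h1 : R.comulA (sliceL ω R.val) = sliceL ω ((conjR R.inv R.val).rTensor A R.val) := by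
    rw [sliceL_rTensor, conjR_apply, comulA_apply]
  rw [h1, ← leg12_leg23_leg12, ← leg13_mul_leg23]
  conv_lhs => rw [eq_sum_sliceL e R.val]
  simp only [map_sum, Finset.sum_mul, Finset.mul_sum]
  simp
  exact Finset.sum_comm

theorem comulA_coassoc (R : PentagonSolution k A) (x : A) :
    TensorProduct.assoc k A A A (R.comulA.toLinearMap.rTensor A (R.comulA x)) =
      R.comulA.toLinearMap.lTensor A (R.comulA x) := by
  let F : A ⊗[k] A →ₐ[k] A ⊗[k] (A ⊗[k] A) :=
    (Algebra.TensorProduct.assoc k k k A A A).toAlgHom.comp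
      (Algebra.TensorProduct.map R.comulA (AlgHom.id k A))
  have hF : ∀ X, TensorProduct.assoc k A A A (R.comulA.toLinearMap.rTensor A X) = F X :=
    fun X => rfl
  have hFR : F R.val = leg13 R.val * leg23 R.val := by
    rw [leg13_mul_leg23]
    apply (Algebra.TensorProduct.assoc k k k A A A).symm.injective
    rw [leg12_leg23_leg12]
    exact (Algebra.TensorProduct.assoc k k k A A A).symm_apply_apply _
  have hG : ∀ X, R.comulA.toLinearMap.lTensor A X = leg23 R.inv * leg13 X * leg23 R.val := by
    intro X
    induction X with
    | zero => simp
    | add x y hx hy => rw [map_add, map_add, mul_add, add_mul, hx, hy]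
    | tmul a b => simp [comulA_apply]
  have hFinv : F R.inv = leg23 R.inv * leg13 R.inv := by
    have h1 : F R.inv * (leg13 R.val * leg23 R.val) = 1 := by
      rw [← hFR, ← map_mul, R.inv_mul_val, map_one]
    have h2 : leg13 R.val * leg23 R.val * (leg23 R.inv * leg13 R.inv) = 1 := by
      rw [mul_assoc, ← mul_assoc (leg23 R.val), ← map_mul, R.val_mul_inv, map_one, one_mul,
        ← map_mul, R.val_mul_inv, map_one]
    exact left_inv_eq_right_inv h1 h2
  rw [hF, hG, comulA_apply, map_mul, map_mul, hFinv, hFR, map_mul, map_mul]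
  have h3 : F (1 ⊗ₜ[k] x) = leg13 (1 ⊗ₜ[k] x) := by
    simp [F, Algebra.TensorProduct.one_def]
  rw [h3]
  simp only [mul_assoc]

theorem sliceL_mul (ω : Module.Dual k A) {ι : Type*} [Fintype ι]
    (e : Module.Basis ι k A) (X Y : A ⊗[k] A) :
    sliceL ω (X * Y) = ∑ i, ∑ j, ω (e i * e j) •
      (sliceL (e.coord i) X * sliceL (e.coord j) Y) := by
  conv_lhs => rw [eq_sum_sliceL e X, eq_sum_sliceL e Y]
  simp only [map_sum, Finset.sum_mul, Finset.mul_sum]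
  simp
  exact Finset.sum_comm

section FiniteDimensional

variable [FiniteDimensional k A]

theorem one_inv_leftCoeff (R : PentagonSolution k A) :
    (∀ ω : Module.Dual k A, sliceL ω (1 : A ⊗[k] A) ∈ leftCoeff R.val) ∧
      ∀ ω : Module.Dual k A, sliceL ω R.inv ∈ leftCoeff R.val := by
  let N : Submodule k (A ⊗[k] A) := ⨅ ω : Module.Dual k A, (leftCoeff R.val).comap (sliceL ω)
  have hN : ∀ X, X ∈ N ↔ ∀ ω : Module.Dual k A, sliceL ω X ∈ leftCoeff R.val := by
    intro X; simp [N]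
  have key := mem_of_mul_mem N R.isUnit.unit ((hN _).2 fun ω => sliceL_mem _ ω) (by
    intro X hX
    rw [hN] at hX ⊢
    intro ω
    rw [eq_sum_sliceL (Module.finBasis k A) X, Finset.mul_sum, map_sum]
    refine Submodule.sum_mem _ fun i _ => ?_
    rw [sliceL_mul_tmul]
    exact R.mul_mem_leftCoeff (sliceL_mem _ _) (hX _))
  exact ⟨(hN _).1 key.1, (hN _).1 key.2⟩

theorem one_inv_rightCoeff (R : PentagonSolution k A) :
    (∀ ω : Module.Dual k A, sliceR ω (1 : A ⊗[k] A) ∈ rightCoeff R.val) ∧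
      ∀ ω : Module.Dual k A, sliceR ω R.inv ∈ rightCoeff R.val := by
  let N : Submodule k (A ⊗[k] A) := ⨅ ω : Module.Dual k A, (rightCoeff R.val).comap (sliceR ω)
  have hN : ∀ X, X ∈ N ↔ ∀ ω : Module.Dual k A, sliceR ω X ∈ rightCoeff R.val := by
    intro X; simp [N]
  have key := mem_of_mul_mem N R.isUnit.unit ((hN _).2 fun ω => sliceR_mem _ ω) (by
    intro X hX
    rw [hN] at hX ⊢
    intro ω
    rw [eq_sum_sliceR (Module.finBasis k A) X, Finset.mul_sum, map_sum]
    refine Submodule.sum_mem _ fun i _ => ?_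
    rw [sliceR_mul_tmul]
    exact R.mul_mem_rightCoeff (sliceR_mem _ _) (hX _))
  exact ⟨(hN _).1 key.1, (hN _).1 key.2⟩

theorem one_mem_leftCoeff (R : PentagonSolution k A) : (1 : A) ∈ leftCoeff R.val := by
  by_cases h : (1 : A) = 0
  · rw [h]; exact Submodule.zero_mem _
  · obtain ⟨ω, hω⟩ := exists_dual_one (k := k) h
    simpa [Algebra.TensorProduct.one_def, hω] using R.one_inv_leftCoeff.1 ω

theorem one_mem_rightCoeff (R : PentagonSolution k A) : (1 : A) ∈ rightCoeff R.val := by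
  by_cases h : (1 : A) = 0
  · rw [h]; exact Submodule.zero_mem _
  · obtain ⟨ω, hω⟩ := exists_dual_one (k := k) h
    simpa [Algebra.TensorProduct.one_def, hω] using R.one_inv_rightCoeff.1 ω

/-- The algebra `P(A, R)`: the space of left coefficients of `R`, as a subalgebra of `A`. -/
def P (R : PentagonSolution k A) : Subalgebra k A :=
  (leftCoeff R.val).toSubalgebra R.one_mem_leftCoeff fun _ _ => R.mul_mem_leftCoeff

theorem mem_P (R : PentagonSolution k A) {x : A} : x ∈ R.P ↔ ∃ ω, sliceL ω R.val = x := Iff.rfl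

/-- The inclusion `P ⊗ P → A ⊗ A`. -/
def inclTwo (R : PentagonSolution k A) : R.P ⊗[k] R.P →ₐ[k] A ⊗[k] A :=
  Algebra.TensorProduct.map R.P.val R.P.val

theorem inclTwo_injective (R : PentagonSolution k A) : Function.Injective R.inclTwo :=
  TensorProduct.map_injective_of_flat_flat
    R.P.val.toLinearMap R.P.val.toLinearMap Subtype.val_injective Subtype.val_injective

theorem comulA_mem (R : PentagonSolution k A) (x : R.P) :
    R.comulA x ∈ LinearMap.range R.inclTwo.toLinearMap := by
  obtain ⟨_, ω, rfl⟩ := x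
  change R.comulA (sliceL ω R.val) ∈ _
  rw [R.comulA_sliceL (Module.finBasis k A)]
  refine Submodule.sum_mem _ fun i _ => Submodule.sum_mem _ fun j _ => Submodule.smul_mem _ _ ?_
  exact ⟨(⟨_, sliceL_mem R.val _⟩ : R.P) ⊗ₜ[k] (⟨_, sliceL_mem R.val _⟩ : R.P), rfl⟩

/-- The comultiplication `Δ(x) = R⁻¹ (1 ⊗ x) R` of `P(A, R)`. -/
def comulP (R : PentagonSolution k A) : R.P →ₗ[k] R.P ⊗[k] R.P :=
  (LinearEquiv.ofInjective R.inclTwo.toLinearMap R.inclTwo_injective).symm.toLinearMap ∘ₗ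
    (R.comulA.toLinearMap ∘ₗ R.P.val.toLinearMap).codRestrict
      (LinearMap.range R.inclTwo.toLinearMap) R.comulA_mem

theorem inclTwo_comulP (R : PentagonSolution k A) (x : R.P) :
    R.inclTwo (R.comulP x) = R.inv * ((1 : A) ⊗ₜ[k] (x : A)) * R.val := by
  rw [← comulA_apply]
  exact congrArg Subtype.val ((LinearEquiv.ofInjective R.inclTwo.toLinearMap
    R.inclTwo_injective).apply_symm_apply ⟨R.comulA x, R.comulA_mem x⟩)

/-- A linear form on `A` with `∑ ⟨ε, R¹⟩ R² = 1`; its restriction to `P(A, R)` is unique. -/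
def counitA (R : PentagonSolution k A) : Module.Dual k A := R.one_mem_rightCoeff.choose

theorem sliceR_counitA (R : PentagonSolution k A) : sliceR R.counitA R.val = 1 :=
  R.one_mem_rightCoeff.choose_spec

/-- The counit of `P(A, R)`, which sends `∑ ⟨ω, R²⟩ R¹` to `⟨ω, 1⟩`. -/
def counitP (R : PentagonSolution k A) : R.P →ₗ[k] k := R.counitA ∘ₗ R.P.val.toLinearMap

theorem counitA_sliceL (R : PentagonSolution k A) (ω : Module.Dual k A) :
    R.counitA (sliceL ω R.val) = ω 1 := by
  rw [slice_comm, sliceR_counitA]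

theorem counitP_sliceL (R : PentagonSolution k A) (ω : Module.Dual k A) :
    R.counitP ⟨sliceL ω R.val, sliceL_mem _ ω⟩ = ω 1 := R.counitA_sliceL ω

theorem exists_antipode (R : PentagonSolution k A) : ∃ S : R.P →ₗ[k] R.P,
    ∀ ω : Module.Dual k A,
      (S ⟨sliceL ω R.val, sliceL_mem _ ω⟩ : A) = sliceL ω R.inv := by
  obtain ⟨g, hg⟩ := (sliceLMap R.val).rangeRestrict.exists_rightInverse_of_surjective
    (LinearMap.range_rangeRestrict _)
  have hg' : ∀ x : R.P, sliceL (g x) R.val = x := fun x =>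
    congrArg Subtype.val (LinearMap.congr_fun hg x)
  refine ⟨((sliceLMap R.inv) ∘ₗ g).codRestrict (leftCoeff R.val)
    (fun x => R.one_inv_leftCoeff.2 _), fun ω => ?_⟩
  change sliceLMap R.inv (g ⟨sliceL ω R.val, sliceL_mem _ ω⟩) = sliceLMap R.inv ω
  have h0 : sliceL (g ⟨sliceL ω R.val, sliceL_mem _ ω⟩) R.val = sliceL ω R.val :=
    hg' ⟨sliceL ω R.val, sliceL_mem _ ω⟩
  generalize g ⟨sliceL ω R.val, sliceL_mem _ ω⟩ = g' at *
  refine (Module.forall_dual_apply_eq_zero_iff k _).1 ?_ |> sub_eq_zero.1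
  intro μ
  obtain ⟨ν, hν⟩ := R.one_inv_rightCoeff.2 μ
  have hν' : sliceR ν R.val = sliceR μ R.inv := hν
  rw [map_sub, sub_eq_zero]
  change μ (sliceL g' R.inv) = μ (sliceL ω R.inv)
  rw [slice_comm, slice_comm, ← hν', ← slice_comm, ← slice_comm]
  exact congrArg ν h0

/-- The antipode of `P(A, R)`, which sends `∑ ⟨ω, R²⟩ R¹` to `∑ ⟨ω, U²⟩ U¹`, for `U = R⁻¹`. -/
def antipodeP (R : PentagonSolution k A) : R.P →ₗ[k] R.P := R.exists_antipode.choose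

theorem antipodeP_sliceL (R : PentagonSolution k A) (ω : Module.Dual k A) :
    (R.antipodeP ⟨sliceL ω R.val, sliceL_mem _ ω⟩ : A) = sliceL ω R.inv :=
  R.exists_antipode.choose_spec ω

theorem counitP_mul (R : PentagonSolution k A) (x y : R.P) :
    R.counitP (x * y) = R.counitP x * R.counitP y := by
  obtain ⟨_, s, rfl⟩ := x
  obtain ⟨_, t, rfl⟩ := y
  change R.counitA (sliceL s R.val * sliceL t R.val) =
    R.counitA (sliceL s R.val) * R.counitA (sliceL t R.val)
  rw [sliceL_mul_sliceL, leg12_mul_leg13, leg23_leg12_leg23, sliceL_lTensor]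
  simp only [counitA_sliceL, LinearMap.comp_apply, conjL_apply, ← Algebra.TensorProduct.one_def,
    mul_one, R.val_mul_inv]
  rw [Algebra.TensorProduct.one_def, dualMul_tmul]

theorem counitP_one [Nontrivial A] (R : PentagonSolution k A) : R.counitP 1 = 1 := by
  obtain ⟨ω, hω⟩ := exists_dual_one (k := k) (one_ne_zero (α := A))
  have h := R.counitP_mul 1 ⟨sliceL ω R.val, sliceL_mem _ ω⟩
  rw [one_mul, counitP_sliceL, hω, mul_one] at h
  exact h.symm

theorem sum_counitA_left (R : PentagonSolution k A) {ι : Type*} [Fintype ι]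
    (e : Module.Basis ι k A) :
    ∑ i, R.counitA (sliceL (e.coord i) R.val) • e i = 1 := by
  rw [← R.sliceR_counitA]
  conv_rhs => rw [eq_sum_sliceL e R.val]
  simp

theorem sliceR_counitA_comulA (R : PentagonSolution k A) (ω : Module.Dual k A) :
    sliceR R.counitA (R.comulA (sliceL ω R.val)) = sliceL ω R.val := by
  let e := Module.finBasis k A
  have h : sliceL ω R.val = ∑ j, ω (1 * e j) • sliceL (e.coord j) R.val := by
    conv_lhs => rw [eq_sum_sliceL e R.val]
    simp
  rw [R.comulA_sliceL e, h, ← R.sum_counitA_left e, Finset.sum_comm]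
  simp [Finset.sum_mul, Finset.sum_smul, smul_smul, mul_comm]

theorem sliceL_counitA_comulA (R : PentagonSolution k A) (ω : Module.Dual k A) :
    sliceL R.counitA (R.comulA (sliceL ω R.val)) = sliceL ω R.val := by
  let e := Module.finBasis k A
  have h : sliceL ω R.val = ∑ j, ω (e j * 1) • sliceL (e.coord j) R.val := by
    conv_lhs => rw [eq_sum_sliceL e R.val]
    simp
  rw [R.comulA_sliceL e, h, ← R.sum_counitA_left e]
  simp [Finset.mul_sum, Finset.sum_smul, smul_smul, mul_comm]

theorem val_lid_rTensor (R : PentagonSolution k A) (y : R.P ⊗[k] R.P) :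
    (TensorProduct.lid k R.P (R.counitP.rTensor R.P y) : A) = sliceR R.counitA (R.inclTwo y) := by
  induction y with
  | zero => simp
  | add x y hx hy => simp only [map_add, Subalgebra.coe_add, hx, hy]
  | tmul a b => simp [inclTwo, counitP]

theorem val_rid_lTensor (R : PentagonSolution k A) (y : R.P ⊗[k] R.P) :
    (TensorProduct.rid k R.P (R.counitP.lTensor R.P y) : A) = sliceL R.counitA (R.inclTwo y) := by
  induction y with
  | zero => simp
  | add x y hx hy => simp only [map_add, Subalgebra.coe_add, hx, hy]
  | tmul a b => simp [inclTwo, counitP]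

theorem inclTwo_comulP' (R : PentagonSolution k A) (x : R.P) :
    R.inclTwo (R.comulP x) = R.comulA x := by
  rw [inclTwo_comulP, comulA_apply]

/-- The inclusion `P ⊗ P ⊗ P → A ⊗ A ⊗ A`. -/
def inclThree (R : PentagonSolution k A) :
    R.P ⊗[k] (R.P ⊗[k] R.P) →ₐ[k] A ⊗[k] (A ⊗[k] A) :=
  Algebra.TensorProduct.map R.P.val R.inclTwo

theorem inclThree_injective (R : PentagonSolution k A) : Function.Injective R.inclThree :=
  TensorProduct.map_injective_of_flat_flat
    R.P.val.toLinearMap R.inclTwo.toLinearMap Subtype.val_injective R.inclTwo_injective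

set_option synthInstance.maxHeartbeats 200000 in
theorem inclThree_rTensor (R : PentagonSolution k A) (y : R.P ⊗[k] R.P) :
    R.inclThree (TensorProduct.assoc k R.P R.P R.P (R.comulP.rTensor R.P y)) =
      TensorProduct.assoc k A A A (R.comulA.toLinearMap.rTensor A (R.inclTwo y)) := by
  have h : ∀ (z : R.P ⊗[k] R.P) (b : R.P),
      R.inclThree (TensorProduct.assoc k R.P R.P R.P (z ⊗ₜ[k] b)) =
        TensorProduct.assoc k A A A (R.inclTwo z ⊗ₜ[k] (b : A)) := by
    intro z b
    induction z with
    | zero => simp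
    | add x y hx hy => simp only [TensorProduct.add_tmul, map_add, hx, hy]
    | tmul c d => simp [inclThree, inclTwo]
  induction y with
  | zero => simp
  | add x y hx hy => simp only [map_add, hx, hy]
  | tmul a b =>
    rw [LinearMap.rTensor_tmul, h, inclTwo_comulP']
    simp [inclTwo]

theorem inclThree_lTensor (R : PentagonSolution k A) (y : R.P ⊗[k] R.P) :
    R.inclThree (R.comulP.lTensor R.P y) =
      R.comulA.toLinearMap.lTensor A (R.inclTwo y) := by
  induction y with
  | zero => simp
  | add x y hx hy => simp only [map_add, hx, hy]
  | tmul a b =>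
    rw [LinearMap.lTensor_tmul]
    simp [inclThree, inclTwo_comulP']
    simp [inclTwo]

instance instCoalgebra (R : PentagonSolution k A) : Coalgebra k R.P where
  comul := R.comulP
  counit := R.counitP
  coassoc := by
    ext x
    apply R.inclThree_injective
    simp only [LinearMap.comp_apply, LinearEquiv.coe_coe]
    rw [inclThree_rTensor, inclThree_lTensor, inclTwo_comulP', comulA_coassoc]
  rTensor_counit_comp_comul := by
    ext x
    obtain ⟨_, ω, rfl⟩ := x
    apply (TensorProduct.lid k R.P).injective
    apply Subtype.ext
    rw [LinearMap.comp_apply, val_lid_rTensor, inclTwo_comulP']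
    refine (R.sliceR_counitA_comulA ω).trans ?_
    simp
    rfl
  lTensor_counit_comp_comul := by
    ext x
    obtain ⟨_, ω, rfl⟩ := x
    apply (TensorProduct.rid k R.P).injective
    apply Subtype.ext
    rw [LinearMap.comp_apply, val_rid_lTensor, inclTwo_comulP']
    refine (R.sliceL_counitA_comulA ω).trans ?_
    simp
    rfl

instance instBialgebra [Nontrivial A] (R : PentagonSolution k A) : Bialgebra k R.P :=
  Bialgebra.mk' k R.P R.counitP_one (R.counitP_mul _ _)
    (R.inclTwo_injective (by
      change R.inclTwo (R.comulP 1) = _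
      rw [inclTwo_comulP', map_one, Subalgebra.coe_one, map_one]))
    (R.inclTwo_injective (by
      refine (R.inclTwo_comulP' _).trans (Eq.trans ?_ (map_mul R.inclTwo _ _).symm)
      rw [Subalgebra.coe_mul, map_mul]
      exact congrArg₂ _ (R.inclTwo_comulP' _).symm (R.inclTwo_comulP' _).symm))

theorem exists_antipodeA (R : PentagonSolution k A) : ∃ S : A →ₗ[k] A,
    (∀ x : R.P, S x = R.antipodeP x) ∧ S.rTensor A R.val = R.inv := by
  obtain ⟨S, hS⟩ := (R.P.val.toLinearMap ∘ₗ R.antipodeP).exists_extend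
    (p := Subalgebra.toSubmodule R.P)
  have h : ∀ x : R.P, S x = R.antipodeP x := fun x => LinearMap.congr_fun hS x
  refine ⟨S, h, ext_sliceL fun ω => ?_⟩
  rw [sliceL_rTensor]
  exact (h ⟨_, sliceL_mem _ ω⟩).trans (R.antipodeP_sliceL ω)

instance instHopfAlgebra [Nontrivial A] (R : PentagonSolution k A) : HopfAlgebra k R.P where
  antipode := R.antipodeP
  mul_antipode_rTensor_comul := by
    obtain ⟨S, hS, hSR⟩ := R.exists_antipodeA
    have key : ∀ y : R.P ⊗[k] R.P, (LinearMap.mul' k R.P (R.antipodeP.rTensor R.P y) : A) =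
        LinearMap.mul' k A (S.rTensor A (R.inclTwo y)) := by
      intro y
      induction y with
      | zero => simp
      | add x y hx hy => simp only [map_add, Subalgebra.coe_add, hx, hy]
      | tmul a b => simp [inclTwo, hS]
    ext x
    obtain ⟨_, ω, rfl⟩ := x
    refine (key (R.comulP _)).trans ?_
    rw [inclTwo_comulP']
    change LinearMap.mul' k A (S.rTensor A (R.comulA (sliceL ω R.val))) =
      algebraMap k A (R.counitA (sliceL ω R.val))
    rw [counitA_sliceL, R.comulA_sliceL (Module.finBasis k A)]
    have h := sliceL_mul ω (Module.finBasis k A) R.inv R.val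
    rw [R.inv_mul_val, ← hSR] at h
    simp only [sliceL_rTensor] at h
    simp [Algebra.TensorProduct.one_def] at h
    simp [← h, Algebra.algebraMap_eq_smul_one]
  mul_antipode_lTensor_comul := by
    obtain ⟨S, hS, hSR⟩ := R.exists_antipodeA
    have key : ∀ y : R.P ⊗[k] R.P, (LinearMap.mul' k R.P (R.antipodeP.lTensor R.P y) : A) =
        LinearMap.mul' k A (S.lTensor A (R.inclTwo y)) := by
      intro y
      induction y with
      | zero => simp
      | add x y hx hy => simp only [map_add, Subalgebra.coe_add, hx, hy]
      | tmul a b => simp [inclTwo, hS]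
    ext x
    obtain ⟨_, ω, rfl⟩ := x
    refine (key (R.comulP _)).trans ?_
    rw [inclTwo_comulP']
    change LinearMap.mul' k A (S.lTensor A (R.comulA (sliceL ω R.val))) =
      algebraMap k A (R.counitA (sliceL ω R.val))
    rw [counitA_sliceL, R.comulA_sliceL (Module.finBasis k A)]
    have h := sliceL_mul ω (Module.finBasis k A) R.val R.inv
    rw [R.val_mul_inv, ← hSR] at h
    simp only [sliceL_rTensor] at h
    simp [Algebra.TensorProduct.one_def] at h
    simp [← h, Algebra.algebraMap_eq_smul_one]

end FiniteDimensional

theorem leg12_map {B : Type*} [Ring B] [Algebra k B] (f : A →ₐ[k] B) (X : A ⊗[k] A) :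
    leg12 (Algebra.TensorProduct.map f f X) =
      Algebra.TensorProduct.map f (Algebra.TensorProduct.map f f) (leg12 X) := by
  induction X with
  | zero => simp
  | add x y hx hy => simp only [map_add, hx, hy]
  | tmul a b => simp

theorem leg13_map {B : Type*} [Ring B] [Algebra k B] (f : A →ₐ[k] B) (X : A ⊗[k] A) :
    leg13 (Algebra.TensorProduct.map f f X) =
      Algebra.TensorProduct.map f (Algebra.TensorProduct.map f f) (leg13 X) := by
  induction X with
  | zero => simp
  | add x y hx hy => simp only [map_add, hx, hy]
  | tmul a b => simp

theorem leg23_map {B : Type*} [Ring B] [Algebra k B] (f : A →ₐ[k] B) (X : A ⊗[k] A) :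
    leg23 (Algebra.TensorProduct.map f f X) =
      Algebra.TensorProduct.map f (Algebra.TensorProduct.map f f) (leg23 X) := by
  simp

end PentagonSolution

section Action

variable {k A : Type*} [Field k] [Ring A] [Algebra k A]

/-- `(u, X) ↦ (u ⊗ u) X (u ⊗ u)⁻¹`. -/
def conjTensor (u : Aˣ) (X : A ⊗[k] A) : A ⊗[k] A :=
  ((u : A) ⊗ₜ[k] (u : A)) * X * (((u⁻¹ : Aˣ) : A) ⊗ₜ[k] ((u⁻¹ : Aˣ) : A))

/-- The inner automorphism `x ↦ u x u⁻¹`. -/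
def innerHom (k : Type*) {A : Type*} [Field k] [Ring A] [Algebra k A] (u : Aˣ) : A →ₐ[k] A :=
  AlgHom.ofLinearMap
    (LinearMap.mulRight k ((u⁻¹ : Aˣ) : A) ∘ₗ LinearMap.mulLeft k (u : A)) (by simp)
    (by intro x y; simp [mul_assoc])

theorem conjTensor_eq_map (u : Aˣ) (X : A ⊗[k] A) :
    conjTensor u X = Algebra.TensorProduct.map (innerHom k u) (innerHom k u) X := by
  unfold conjTensor
  induction X with
  | zero => simp
  | add x y hx hy => rw [mul_add, add_mul, map_add, hx, hy]
  | tmul a b => simp [innerHom]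

theorem conjTensor_one (X : A ⊗[k] A) : conjTensor 1 X = X := by
  simp [conjTensor, ← Algebra.TensorProduct.one_def]

theorem conjTensor_mul (u v : Aˣ) (X : A ⊗[k] A) :
    conjTensor (u * v) X = conjTensor u (conjTensor v X) := by
  have h1 : ((u * v : Aˣ) : A) ⊗ₜ[k] ((u * v : Aˣ) : A) =
      (u : A) ⊗ₜ[k] (u : A) * (v : A) ⊗ₜ[k] (v : A) := by
    simp
  have h2 : (((u * v)⁻¹ : Aˣ) : A) ⊗ₜ[k] (((u * v)⁻¹ : Aˣ) : A) =
      ((v⁻¹ : Aˣ) : A) ⊗ₜ[k] ((v⁻¹ : Aˣ) : A) * ((u⁻¹ : Aˣ) : A) ⊗ₜ[k] ((u⁻¹ : Aˣ) : A) := by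
    simp
  simp only [conjTensor, h1, h2, mul_assoc]

theorem isPentagon_conjTensor (u : Aˣ) {R : A ⊗[k] A} (hR : IsPentagon R) :
    IsPentagon (conjTensor u R) := by
  unfold IsPentagon at *
  rw [conjTensor_eq_map, PentagonSolution.leg12_map, PentagonSolution.leg13_map,
    PentagonSolution.leg23_map, ← map_mul, ← map_mul, hR, map_mul]

theorem exists_sum_tmul (X : A ⊗[k] A) :
    ∃ m : ℕ, ∃ a b : Fin m → A, X = ∑ i, a i ⊗ₜ[k] b i := by
  obtain ⟨S, hS⟩ := TensorProduct.exists_finset X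
  refine ⟨S.card, fun i => (S.equivFin.symm i).1.1, fun i => (S.equivFin.symm i).1.2, ?_⟩
  rw [hS, ← Finset.sum_coe_sort,
    ← Equiv.sum_comp S.equivFin.symm (fun p : S => p.1.1 ⊗ₜ[k] p.1.2)]

theorem tensorLength_map_le (f : A →ₐ[k] A) (X : A ⊗[k] A) :
    tensorLength (Algebra.TensorProduct.map f f X) ≤ tensorLength X := by
  obtain ⟨a, b, h⟩ : ∃ a b : Fin (tensorLength X) → A, X = ∑ i, a i ⊗ₜ[k] b i :=
    Nat.sInf_mem (exists_sum_tmul X)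
  refine Nat.sInf_le ⟨fun i => f (a i), fun i => f (b i), ?_⟩
  conv_lhs => rw [h]
  simp

theorem tensorLength_conjTensor (u : Aˣ) (X : A ⊗[k] A) :
    tensorLength (conjTensor u X) = tensorLength X := by
  have h : ∀ (v : Aˣ) (Y : A ⊗[k] A), tensorLength (conjTensor v Y) ≤ tensorLength Y := by
    intro v Y
    rw [conjTensor_eq_map]
    exact tensorLength_map_le _ _
  refine le_antisymm (h u X) ?_
  have h2 := h u⁻¹ (conjTensor u X)
  rwa [← conjTensor_mul, inv_mul_cancel, conjTensor_one] at h2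

instance : MulAction Aˣ (PentagonSolution k A) where
  smul u R :=
    { val := conjTensor u R.val
      isUnit := by
        rw [conjTensor_eq_map]
        exact R.isUnit.map _
      pentagon := isPentagon_conjTensor u R.pentagon }
  one_smul R := PentagonSolution.ext (conjTensor_one R.val)
  mul_smul u v R := PentagonSolution.ext (conjTensor_mul u v R.val)

end Action

/-- The set `Pent_n` of invertible solutions `R ∈ M_n(k) ⊗ M_n(k)` of the pentagon equation with
tensor length `n`. -/
def Pent (k : Type*) [Field k] (n : ℕ) : Type _ :=
  {R : PentagonSolution k (Matrix (Fin n) (Fin n) k) // tensorLength R.val = n}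

/-- The action `(u, R) ↦ (u ⊗ u) R (u ⊗ u)⁻¹` of `GL_n(k)` on `Pent_n`. -/
instance (k : Type*) [Field k] (n : ℕ) :
    MulAction (Matrix.GeneralLinearGroup (Fin n) k) (Pent k n) where
  smul u R := ⟨u • R.1, (tensorLength_conjTensor u R.1.val).trans R.2⟩
  one_smul R := Subtype.ext (one_smul _ R.1)
  mul_smul u v R := Subtype.ext (mul_smul u v R.1)

/-- The set of orbits of the action of `GL_n(k)` on `Pent_n`. -/
abbrev PentOrbits (k : Type*) [Field k] (n : ℕ) : Type _ :=
  MulAction.orbitRel.Quotient (Matrix.GeneralLinearGroup (Fin n) k) (Pent k n)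

/-- The orbit of an element of `Pent_n`. -/
def Pent.orbit {k : Type*} [Field k] {n : ℕ} (R : Pent k n) : PentOrbits k n :=
  Quotient.mk (MulAction.orbitRel (Matrix.GeneralLinearGroup (Fin n) k) (Pent k n)) R

/-- The Hopf algebra `P(n, R)`. -/
abbrev Pent.hopf {k : Type*} [Field k] {n : ℕ} (R : Pent k n) :
    Subalgebra k (Matrix (Fin n) (Fin n) k) := R.1.P

universe u

/-- `n`-dimensional Hopf algebras over `k`, up to isomorphism of Hopf algebras. -/
def hopfSetoid (k : Type u) [Field k] (n : ℕ) :
    Setoid {L : HopfAlgCat.{u} k // Module.finrank k L = n} where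
  r L L' := Nonempty (L.1 ≃ₐc[k] L'.1)
  iseqv :=
    { refl := fun L => ⟨BialgEquiv.refl k L.1⟩
      symm := fun ⟨f⟩ => ⟨f.symm⟩
      trans := fun ⟨f⟩ ⟨g⟩ => ⟨f.trans g⟩ }

/-- The set of types of `n`-dimensional Hopf algebras over `k`. -/
def HopfTypes (k : Type u) [Field k] (n : ℕ) : Type _ := Quotient (hopfSetoid k n)

/-- The type of an `n`-dimensional Hopf algebra. -/
def HopfTypes.mk {k : Type u} [Field k] {n : ℕ} (L : Type u) [Ring L] [HopfAlgebra k L]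
    (h : Module.finrank k L = n) : HopfTypes k n :=
  Quotient.mk (hopfSetoid k n) ⟨HopfAlgCat.of k L, h⟩

end

end PentagonHopf

/-! The theorem rests on two constructions that invert each other.

From Hopf algebras to solutions: for a basis `e` of `L`, the map `f ↦ ∑ f(eᵢ) ⊗ σ(eⁱ)` turns
convolution into multiplication (`canonTensor_mul`). Hence `R = ∑ ρ(eᵢ) ⊗ σ(eⁱ)` has inverse `∑ ρ(S
eᵢ) ⊗ σ(eⁱ)`. If `ρ` and `σ` satisfy the Heisenberg double relation, then `(1 ⊗ ρ x) R = R (ρ ⊗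
ρ)Δ(x)`, which yields the pentagon equation and also identifies the comultiplication of `P(A, R)`
with that of `L`. The Heisenberg double acts on `L*`, of dimension `n`, by multiplication and by
translation; this gives a solution in matrices of size `n` (`exists_pent_bialgEquiv`). Its length is
right because the tensor length of `R` is always the dimension of `P(A, R)`
(`tensorLength_eq_finrank`).

Uniqueness: write `P` for `P(n, R)`. The element `R⁻¹` lies in `P ⊗ Mₙ(k)` and defines a left
coaction of `P` on `kⁿ`. Since `R⁻¹(1 ⊗ x) = Δ(x)R⁻¹`, the space `kⁿ` becomes a Hopf module over
`P`. As in the fundamental theorem of Hopf modules, there is a nonzero coinvariant `w`, and `x ↦ x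
w` is injective on `P` (`exists_coinvariant`). When `dim P = n` it is bijective, so `kⁿ` is `P`
itself with its regular action and coaction. An isomorphism of Hopf algebras thereby transports to
an invertible matrix `u`, and conjugation by `u` carries `R⁻¹` to `R'⁻¹` (`exists_smul_eq`). -/

namespace PentagonHopf

noncomputable section

open Coalgebra WithConv

/-! ### Convolution and the canonical tensor. -/

section Canonical

variable {k L A B ι : Type*} [Field k] [Ring L] [HopfAlgebra k L] [Ring A] [Algebra k A]
  [Ring B] [Algebra k B] [Fintype ι]

/-- `f ↦ ∑ f(eᵢ) ⊗ σ(eⁱ)` for a basis `e` of `L`. -/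
def canonTensor (e : Module.Basis ι k L) (σ : WithConv (L →ₗ[k] k) →ₐ[k] A)
    (f : WithConv (L →ₗ[k] B)) : B ⊗[k] A :=
  ∑ i, f (e i) ⊗ₜ[k] σ (toConv (e.coord i))

variable (e : Module.Basis ι k L) (σ : WithConv (L →ₗ[k] k) →ₐ[k] A)

theorem sum_smul_map_coord {M : Type*} [AddCommGroup M] [Module k M]
    (τ : WithConv (L →ₗ[k] k) →ₗ[k] M) (c : L →ₗ[k] k) :
    ∑ i, c (e i) • τ (toConv (e.coord i)) = τ (toConv c) := by
  conv_rhs => rw [← e.sum_dual_apply_smul_coord c]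
  simp only [← map_smul, ← map_sum]
  congr 1
  ext x
  simp

theorem canonTensor_one : canonTensor e σ (1 : WithConv (L →ₗ[k] B)) = 1 := by
  simp only [canonTensor, LinearMap.convOne_apply, Algebra.algebraMap_eq_smul_one,
    TensorProduct.smul_tmul, ← TensorProduct.tmul_sum]
  rw [show ∑ i, counit (R := k) (e i) • σ (toConv (e.coord i)) = σ 1 from
    sum_smul_map_coord e σ.toLinearMap counit, map_one]
  rfl

/-- For finite-dimensional `L`, the convolution algebra `Hom(L, B)` is `B ⊗ L*`, and the canonical
tensor is `id ⊗ σ` on it. -/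
theorem canonTensor_mul (f g : WithConv (L →ₗ[k] B)) :
    canonTensor e σ (f * g) = canonTensor e σ f * canonTensor e σ g := by
  have h (x : L) : (f * g) x = ∑ i, ∑ j,
      (toConv (e.coord i) * toConv (e.coord j)) x • (f (e i) * g (e j)) := by
    have (z : L ⊗[k] L) : LinearMap.mul' k B (TensorProduct.map f.ofConv g.ofConv z) =
        ∑ i, ∑ j, LinearMap.mul' k k (TensorProduct.map (e.coord i) (e.coord j) z) •
          (f (e i) * g (e j)) := by
      induction z with
      | zero => simp
      | add x y hx hy => simp only [map_add, hx, hy, add_smul, Finset.sum_add_distrib]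
      | tmul a b =>
        have h1 : f.ofConv a * g.ofConv b = f.ofConv (∑ i, e.repr a i • e i) *
          g.ofConv (∑ i, e.repr b i • e i) := by rw [e.sum_repr, e.sum_repr]
        simp only [TensorProduct.map_tmul, LinearMap.mul'_apply, h1, map_sum, map_smul,
          Finset.sum_mul_sum, smul_mul_smul_comm]
        rfl
    exact this _
  simp only [canonTensor, h, TensorProduct.sum_tmul, Finset.sum_mul_sum,
    Algebra.TensorProduct.tmul_mul_tmul, TensorProduct.smul_tmul]
  rw [Finset.sum_comm]
  refine Finset.sum_congr rfl fun i _ => ?_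
  rw [Finset.sum_comm]
  refine Finset.sum_congr rfl fun j _ => ?_
  rw [← TensorProduct.tmul_sum, ← map_mul]
  congr 1
  exact sum_smul_map_coord e σ.toLinearMap _

/-- The canonical element of `L ⊗ L*` absorbs an endomorphism of `L` equally well as its transpose
on `L*`. -/
theorem canonTensor_comp (f : WithConv (L →ₗ[k] B)) (g : L →ₗ[k] L) :
    canonTensor e σ (toConv (f.ofConv ∘ₗ g)) =
      ∑ i, f (e i) ⊗ₜ[k] σ (toConv (e.coord i ∘ₗ g)) := by
  have h (x : L) : f.ofConv (g x) = ∑ i, e.coord i (g x) • f (e i) := by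
    conv_lhs => rw [← e.sum_repr (g x), map_sum]
    simp
  simp only [canonTensor, LinearMap.comp_apply]
  change ∑ i, f.ofConv (g (e i)) ⊗ₜ[k] _ = _
  simp only [h, TensorProduct.sum_tmul, TensorProduct.smul_tmul]
  rw [Finset.sum_comm]
  refine Finset.sum_congr rfl fun i _ => ?_
  rw [← TensorProduct.tmul_sum]
  congr 1
  exact sum_smul_map_coord e σ.toLinearMap (e.coord i ∘ₗ g)

end Canonical

/-! ### The Heisenberg double relation and the pentagon equation. -/

section Heisenberg

variable {k L A ι : Type*} [Field k] [Ring L] [HopfAlgebra k L] [Ring A] [Algebra k A] [Fintype ι]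
  (e : Module.Basis ι k L) (σ : WithConv (L →ₗ[k] k) →ₐ[k] A) (ρ : L →ₐ[k] A)

/-- The relation `ρ(x) σ(ξ) = ∑ σ(x₁ ⇀ ξ) ρ(x₂)` of the Heisenberg double, where
`(x ⇀ ξ)(y) = ξ(yx)`. -/
def IsHeisenberg (σ : WithConv (L →ₗ[k] k) →ₐ[k] A) (ρ : L →ₐ[k] A) : Prop :=
  ∀ (x : L) (ξ : L →ₗ[k] k), ∀ r : Coalgebra.Repr k x (L × L), ρ x * σ (toConv ξ) =
    ∑ i ∈ r.index, σ (toConv (ξ ∘ₗ LinearMap.mulRight k (r.left i))) * ρ (r.right i)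

variable {e σ ρ}

/-- Right multiplication of `R` by `ρ(z) ⊗ 1` replaces `eⁱ` by `z ⇀ eⁱ`, by transposition. With `z =
x₁` and a further factor `1 ⊗ ρ(x₂)`, the second leg is the right side of the Heisenberg relation.
-/
theorem IsHeisenberg.tmul_mul_canonTensor (h : IsHeisenberg σ ρ) (x : L) :
    ((1 : A) ⊗ₜ[k] ρ x) * canonTensor e σ (toConv ρ.toLinearMap) =
      canonTensor e σ (toConv ρ.toLinearMap) * Algebra.TensorProduct.map ρ ρ (comul x) := by
  let r := ℛ k x
  have h1 (z : L) : canonTensor e σ (toConv ρ.toLinearMap) * (ρ z ⊗ₜ[k] 1) =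
      ∑ i, ρ (e i) ⊗ₜ[k] σ (toConv (e.coord i ∘ₗ LinearMap.mulRight k z)) := by
    refine Eq.trans ?_ (canonTensor_comp e σ (toConv ρ.toLinearMap) (LinearMap.mulRight k z))
    simp [canonTensor, Finset.sum_mul]
  have h2 : Algebra.TensorProduct.map ρ ρ (comul x) =
      ∑ i ∈ r.index, (ρ (r.left i) ⊗ₜ[k] 1) * ((1 : A) ⊗ₜ[k] ρ (r.right i)) := by
    rw [← r.eq]
    simp
  rw [h2, Finset.mul_sum]
  simp only [← mul_assoc, h1]
  simp only [canonTensor, Finset.mul_sum, Finset.sum_mul, Algebra.TensorProduct.tmul_mul_tmul,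
    one_mul, mul_one]
  rw [Finset.sum_comm]
  refine Finset.sum_congr rfl fun i _ => ?_
  rw [← TensorProduct.tmul_sum, ← h x _ r]
  rfl

/-- `ρ ∘ S` is the convolution inverse of `ρ`, and the canonical tensor is multiplicative and
unital. -/
theorem canonTensor_mul_antipode :
    canonTensor e σ (toConv ρ.toLinearMap) *
      canonTensor e σ (toConv (ρ.toLinearMap ∘ₗ HopfAlgebra.antipode k)) = 1 := by
  have h := LinearMap.algHom_comp_convMul_distrib ρ (toConv (LinearMap.id : L →ₗ[k] L))
    (toConv (HopfAlgebra.antipode k))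
  rw [LinearMap.id_mul_antipode] at h
  rw [← canonTensor_mul]
  simp only [LinearMap.comp_id] at h
  rw [← toConv_ofConv (_ * _), ← h, ← canonTensor_one e σ]
  congr 1
  ext x
  simp

theorem antipode_mul_canonTensor :
    canonTensor e σ (toConv (ρ.toLinearMap ∘ₗ HopfAlgebra.antipode k)) *
      canonTensor e σ (toConv ρ.toLinearMap) = 1 := by
  have h := LinearMap.algHom_comp_convMul_distrib ρ (toConv (HopfAlgebra.antipode k))
    (toConv (LinearMap.id : L →ₗ[k] L))
  rw [LinearMap.antipode_mul_id] at h
  rw [← canonTensor_mul]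
  simp only [LinearMap.comp_id] at h
  rw [← toConv_ofConv (_ * _), ← h, ← canonTensor_one e σ]
  congr 1
  ext x
  simp

theorem IsHeisenberg.isPentagon (h : IsHeisenberg σ ρ) :
    IsPentagon (canonTensor e σ (toConv ρ.toLinearMap)) := by
  set R := canonTensor e σ (toConv ρ.toLinearMap) with hR
  let α := (Algebra.TensorProduct.assoc k k k A A A).symm
  have h12 (Z : A ⊗[k] A) : α (leg12 Z) = Z ⊗ₜ[k] (1 : A) := by
    induction Z with
    | zero => simp
    | add x y hx hy => simp only [map_add, hx, hy, TensorProduct.add_tmul]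
    | tmul a b => simp [α]
  let i₁ : A →ₐ[k] A ⊗[k] A := Algebra.TensorProduct.includeLeft
  let i₂ : A →ₐ[k] A ⊗[k] A := Algebra.TensorProduct.includeRight
  have h13 : α (leg13 R) = canonTensor e σ (toConv (i₁.comp ρ).toLinearMap) := by
    simp [hR, canonTensor, α, i₁]
  have h23 : α (leg23 R) = canonTensor e σ (toConv (i₂.comp ρ).toLinearMap) := by
    simp [hR, canonTensor, α, i₂]
  -- With the first two legs taken together as the coefficient algebra `A ⊗ A`, this makes `R¹³R²³`
  -- the canonical tensor of `(ρ ⊗ ρ)Δ`. The intertwining relation applied to each `eᵢ` then gives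
  -- the pentagon equation.
  have hc : toConv (i₁.comp ρ).toLinearMap * toConv (i₂.comp ρ).toLinearMap =
      toConv ((Algebra.TensorProduct.map ρ ρ).toLinearMap ∘ₗ comul) := by
    ext x
    rw [(ℛ k x).convMul_apply]
    simp [← (ℛ k x).eq, i₁, i₂]
  refine α.injective ?_
  rw [mul_assoc, map_mul, map_mul α (leg13 R), map_mul, h12, h13, h23, ← canonTensor_mul, hc]
  simp only [canonTensor, Finset.mul_sum, Finset.sum_mul]
  refine Finset.sum_congr rfl fun i _ => ?_
  simp only [Algebra.TensorProduct.tmul_mul_tmul, one_mul, mul_one]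
  congr 1
  exact (h.tmul_mul_canonTensor (e i)).symm

end Heisenberg

/-! ### Uniqueness of counits. -/

section CoalgebraLemmas

/-- A linear equivalence compatible with the comultiplications is compatible with the counits. -/
theorem counit_comp_of_map_comp_comul {k C D : Type*} [Field k] [AddCommGroup C] [Module k C]
    [Coalgebra k C] [AddCommGroup D] [Module k D] [Coalgebra k D] (f : C ≃ₗ[k] D)
    (h : TensorProduct.map f.toLinearMap f.toLinearMap ∘ₗ comul = comul ∘ₗ f.toLinearMap) :
    counit ∘ₗ f.toLinearMap = counit (R := k) (A := C) := by
  ext x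
  have h1 : ∑ i ∈ (ℛ k x).index,
      counit (R := k) (f ((ℛ k x).left i)) • f ((ℛ k x).right i) = f x := by
    have := congrArg (fun z => TensorProduct.lid k D (counit.rTensor D z)) (LinearMap.congr_fun h x)
    rw [LinearMap.comp_apply, LinearMap.comp_apply, ← (ℛ k x).eq] at this
    simpa using this
  have h2 : ∑ i ∈ (ℛ k x).index,
      counit (R := k) (f ((ℛ k x).left i)) • (ℛ k x).right i = x :=
    f.injective (by simpa using h1)
  have h4 : f (∑ i ∈ (ℛ k x).index, counit (R := k) ((ℛ k x).right i) • (ℛ k x).left i) = f x := by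
    have := congrArg (TensorProduct.rid k C) (sum_tmul_counit_eq (R := k) (ℛ k x))
    congr 1
    simpa only [map_sum, TensorProduct.rid_tmul, one_smul] using this
  -- Two-sided counits agree: `h4` uses the counit of `C` on the right factor, and `h2` says that `ε
  -- ∘ f` acts as a counit on the left factor.
  calc counit (R := k) (f x)
      = ∑ i ∈ (ℛ k x).index, counit (R := k) ((ℛ k x).right i) *
          counit (R := k) (f ((ℛ k x).left i)) := by
        rw [← h4]; simp
    _ = counit x := by
        conv_rhs => rw [← h2]
        simp [mul_comm]

end CoalgebraLemmas

/-! ### Tensor length, and recognition of `P(A, R)` up to isomorphism. -/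

namespace PentagonSolution

section

variable {k A L : Type*} [Field k] [Ring A] [Algebra k A] [FiniteDimensional k A]

/-- `R` lies in `P ⊗ A`, so a basis of `P` gives an expression with `dim P` terms. Conversely, the
first factors of any expression span all left coefficients. -/
theorem tensorLength_eq_finrank (R : PentagonSolution k A) :
    tensorLength R.val = Module.finrank k R.P := by
  refine le_antisymm (Nat.sInf_le ?_) ?_
  · let e := Module.finBasis k A
    let b := Module.finBasis k R.P
    let X : R.P ⊗[k] A := ∑ i, (⟨_, sliceL_mem R.val (e.coord i)⟩ : R.P) ⊗ₜ[k] e i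
    have hX : R.P.val.toLinearMap.rTensor A X = R.val := by
      conv_rhs => rw [eq_sum_sliceL e R.val]
      simp [X]
    refine ⟨fun i => b i, fun i => sliceR (b.coord i) X, ?_⟩
    rw [← hX]
    conv_lhs => rw [eq_sum_sliceR b X]
    simp
  · obtain ⟨a, b, h⟩ : ∃ a b : Fin (tensorLength R.val) → A, R.val = ∑ i, a i ⊗ₜ[k] b i :=
      Nat.sInf_mem (exists_sum_tmul R.val)
    have hle : Subalgebra.toSubmodule R.P ≤ Submodule.span k (Set.range a) := by
      rintro _ ⟨ω, rfl⟩
      change sliceL ω R.val ∈ _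
      have h' := congrArg (sliceL ω) h
      rw [map_sum] at h'
      rw [h']
      refine Submodule.sum_mem _ fun i _ => ?_
      rw [sliceL_tmul]
      exact Submodule.smul_mem _ _ (Submodule.subset_span ⟨i, rfl⟩)
    calc Module.finrank k R.P ≤ Module.finrank k (Submodule.span k (Set.range a)) :=
          Submodule.finrank_mono hle
      _ ≤ _ := (finrank_range_le_card a).trans_eq (Fintype.card_fin _)

variable [Nontrivial A] [Ring L] [HopfAlgebra k L]

theorem nonempty_bialgEquiv_P (R : PentagonSolution k A) (ρ : L →ₐ[k] A)
    (hinj : Function.Injective ρ) (hrange : ρ.range = R.P)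
    (hcomul : ∀ x, Algebra.TensorProduct.map ρ ρ (comul x) = R.comulA (ρ x)) :
    Nonempty (L ≃ₐc[k] R.P) := by
  let f : L ≃ₐ[k] R.P :=
    (AlgEquiv.ofInjective ρ hinj).trans (Subalgebra.equivOfEq _ _ hrange)
  have hf (x : L) : (f x : A) = ρ x := rfl
  have hmap (z : L ⊗[k] L) : R.inclTwo (TensorProduct.map f.toLinearMap f.toLinearMap z) =
      Algebra.TensorProduct.map ρ ρ z := by
    induction z with
    | zero => simp
    | add x y hx hy => simp only [map_add, hx, hy]
    | tmul a b => simp [inclTwo, hf]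
  have h : TensorProduct.map f.toLinearMap f.toLinearMap ∘ₗ comul =
      comul ∘ₗ f.toLinearMap := by
    ext x
    apply R.inclTwo_injective
    rw [LinearMap.comp_apply, hmap, hcomul]
    exact (R.inclTwo_comulP' (f x)).symm
  refine ⟨BialgEquiv.ofAlgEquiv f ?_ ?_⟩
  · apply AlgHom.toLinearMap_injective
    exact counit_comp_of_map_comp_comul f.toLinearEquiv h
  · apply AlgHom.toLinearMap_injective
    exact h

end

/-! ### Invariance of `P(A, R)` under conjugation. -/

section Conjugation

variable {k A : Type*} [Field k] [Ring A] [Algebra k A]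

theorem inv_smul_val (u : Aˣ) (R : PentagonSolution k A) :
    (u • R).inv = Algebra.TensorProduct.map (innerHom k u) (innerHom k u) R.inv := by
  refine left_inv_eq_right_inv (u • R).inv_mul_val ?_
  rw [show (u • R).val = _ from conjTensor_eq_map u R.val, ← map_mul, R.val_mul_inv, map_one]

theorem nonempty_bialgEquiv_P_smul [FiniteDimensional k A] [Nontrivial A] (u : Aˣ) (R : PentagonSolution k A) :
    Nonempty (R.P ≃ₐc[k] (u • R).P) := by
  have hval : (u • R).val = Algebra.TensorProduct.map (innerHom k u) (innerHom k u) R.val :=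
    conjTensor_eq_map u R.val
  have hu' (x : A) : innerHom k u⁻¹ (innerHom k u x) = x := by simp [innerHom, mul_assoc]
  have hslice (ω : Module.Dual k A) :
      sliceL ω (u • R).val = innerHom k u (sliceL (ω ∘ₗ (innerHom k u).toLinearMap) R.val) := by
    rw [hval, ← sliceL_lTensor]
    refine Eq.trans ?_ (sliceL_rTensor (innerHom k u).toLinearMap ω _)
    rw [← LinearMap.comp_apply (LinearMap.rTensor _ _), LinearMap.rTensor_comp_lTensor]
    rfl
  refine nonempty_bialgEquiv_P _ ((innerHom k u).comp R.P.val)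
    ((Function.LeftInverse.injective hu').comp Subtype.val_injective) ?_ fun x => ?_
  · ext y
    constructor
    · rintro ⟨⟨_, ω, rfl⟩, rfl⟩
      refine ⟨ω ∘ₗ (innerHom k u⁻¹).toLinearMap, (hslice _).trans ?_⟩
      have : (ω ∘ₗ (innerHom k u⁻¹).toLinearMap) ∘ₗ (innerHom k u).toLinearMap = ω := by
        ext x
        simp [hu']
      rw [this]
      rfl
    · rintro ⟨ω, rfl⟩
      exact ⟨⟨_, sliceL_mem R.val (ω ∘ₗ (innerHom k u).toLinearMap)⟩, (hslice ω).symm⟩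
  · rw [Algebra.TensorProduct.map_comp]
    refine (congrArg (Algebra.TensorProduct.map (innerHom k u) (innerHom k u))
      (R.inclTwo_comulP' x)).trans ?_
    rw [comulA_apply, comulA_apply, inv_smul_val, hval, map_mul, map_mul]
    simp

end Conjugation

end PentagonSolution

/-! ### Realization of every Hopf algebra through the Heisenberg double. -/

section Existence

section

variable {k L A ι : Type*} [Field k] [Ring L] [HopfAlgebra k L] [Ring A] [Algebra k A] [Fintype ι]

/-- The solution of the pentagon equation attached to a representation of the Heisenberg
double. -/
def IsHeisenberg.solution {σ : WithConv (L →ₗ[k] k) →ₐ[k] A} {ρ : L →ₐ[k] A}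
    (h : IsHeisenberg σ ρ) (e : Module.Basis ι k L) : PentagonSolution k A where
  val := canonTensor e σ (toConv ρ.toLinearMap)
  isUnit := ⟨⟨_, _, canonTensor_mul_antipode, antipode_mul_canonTensor⟩, rfl⟩
  pentagon := h.isPentagon

/-- Left coefficients are values of `ρ` by construction. When `σ` is injective the `σ(eⁱ)` are
independent, so every element of `ρ(L)` occurs. -/
theorem IsHeisenberg.range_eq_P [FiniteDimensional k A] {σ : WithConv (L →ₗ[k] k) →ₐ[k] A}
    {ρ : L →ₐ[k] A} (h : IsHeisenberg σ ρ) (e : Module.Basis ι k L)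
    (hσ : Function.Injective σ) : ρ.range = (h.solution e).P := by
  have hslice (ω : Module.Dual k A) : sliceL ω (h.solution e).val =
      ρ (∑ i, ω (σ (toConv (e.coord i))) • e i) := by
    simp [solution, canonTensor]
  ext y
  constructor
  · rintro ⟨x, rfl⟩
    obtain ⟨g, hg⟩ := σ.toLinearMap.exists_leftInverse_of_injective (LinearMap.ker_eq_bot.2 hσ)
    let ev : WithConv (L →ₗ[k] k) →ₗ[k] k :=
      LinearMap.applyₗ x ∘ₗ (WithConv.linearEquiv k (L →ₗ[k] k)).toLinearMap
    -- Evaluation at `x`, pulled back along a left inverse of `σ`, sends `σ(eⁱ)` to the `i`-th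
    -- coordinate of `x`.
    refine ⟨ev ∘ₗ g, (hslice _).trans ?_⟩
    have hg' (c) : g (σ c) = c := LinearMap.congr_fun hg c
    simp only [LinearMap.comp_apply, hg']
    change ρ (∑ i, e.repr x i • e i) = ρ x
    rw [e.sum_repr]
  · rintro ⟨ω, rfl⟩
    exact ⟨_, (hslice ω).symm⟩

theorem IsHeisenberg.comulA_solution {σ : WithConv (L →ₗ[k] k) →ₐ[k] A}
    {ρ : L →ₐ[k] A} (h : IsHeisenberg σ ρ) (e : Module.Basis ι k L) (x : L) :
    Algebra.TensorProduct.map ρ ρ (comul x) = (h.solution e).comulA (ρ x) := by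
  rw [PentagonSolution.comulA_apply, mul_assoc]
  erw [h.tmul_mul_canonTensor x]
  rw [← mul_assoc]
  erw [(h.solution e).inv_mul_val]
  rw [one_mul]

end

variable (k L : Type*) [Field k] [Ring L] [HopfAlgebra k L]

/-- The action `(x ⇀ ξ)(y) = ξ(yx)` of `L` on its dual. -/
def dualAction :
    L →ₐ[k] Module.End k (WithConv (L →ₗ[k] k)) :=
  AlgHom.ofLinearMap
    { toFun x :=
        { toFun ξ := toConv (ξ.ofConv ∘ₗ LinearMap.mulRight k x)
          map_add' _ _ := rfl
          map_smul' _ _ := rfl }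
      map_add' x y := by
        ext ξ z
        exact (congrArg ξ.ofConv (mul_add z x y)).trans (map_add ξ.ofConv _ _)
      map_smul' c x := by
        ext ξ z
        exact (congrArg ξ.ofConv (mul_smul_comm c z x)).trans (map_smul ξ.ofConv _ _) }
    (by ext ξ z; exact congrArg ξ.ofConv (mul_one z))
    (by intro x y; ext ξ z; exact congrArg ξ.ofConv (mul_assoc z x y).symm)

variable {k L}

theorem dualAction_apply (x : L) (ξ : WithConv (L →ₗ[k] k)) :
    dualAction k L x ξ = toConv (ξ.ofConv ∘ₗ LinearMap.mulRight k x) := rfl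

/-- This is the module algebra identity `x ⇀ (ξη) = ∑ (x₁ ⇀ ξ)(x₂ ⇀ η)`, which follows from `Δ(yx) =
Δ(y)Δ(x)`. -/
theorem isHeisenberg_lmul_dualAction :
    IsHeisenberg (A := Module.End k (WithConv (L →ₗ[k] k))) (Algebra.lmul k (WithConv (L →ₗ[k] k))) (dualAction k L) := by
  intro x ξ r
  ext η y
  simp only [Module.End.mul_apply, LinearMap.sum_apply, dualAction_apply, ofConv_sum]
  change (toConv ξ * η) (y * x) = ∑ i ∈ r.index, (toConv (ξ ∘ₗ LinearMap.mulRight k (r.left i)) *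
    toConv (η.ofConv ∘ₗ LinearMap.mulRight k (r.right i))) y
  rw [((ℛ k y).mul r).convMul_apply]
  simp only [(ℛ k y).convMul_apply]
  rw [Finset.sum_comm]
  simp [Finset.sum_product]

theorem dualAction_injective : Function.Injective (dualAction k L) := by
  intro x y h
  rw [← sub_eq_zero, ← Module.forall_dual_apply_eq_zero_iff k]
  intro ξ
  have := congrArg WithConv.ofConv (LinearMap.congr_fun h (toConv ξ))
  have := LinearMap.congr_fun this 1
  simpa [dualAction_apply, sub_eq_zero] using this

theorem isHeisenberg_comp {A B : Type*} [Ring A] [Algebra k A] [Ring B] [Algebra k B]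
    {σ : WithConv (L →ₗ[k] k) →ₐ[k] A} {ρ : L →ₐ[k] A} (h : IsHeisenberg σ ρ) (f : A →ₐ[k] B) :
    IsHeisenberg (f.comp σ) (f.comp ρ) := by
  intro x ξ r
  simpa using congrArg f (h x ξ r)

theorem exists_pent_bialgEquiv (k : Type*) [Field k] (n : ℕ) [NeZero n] (L : Type*) [Ring L]
    [HopfAlgebra k L] (hn : Module.finrank k L = n) :
    ∃ R : Pent k n, Nonempty (L ≃ₐc[k] R.hopf) := by
  -- Here `n ≥ 1` matters: `finrank` is also `0` for infinite-dimensional spaces.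
  have : FiniteDimensional k L := Module.finite_of_finrank_pos (by rw [hn]; exact NeZero.pos n)
  have e : Module.Basis (Fin n) k L := Module.finBasisOfFinrankEq k L hn
  have b : Module.Basis (Fin n) k (WithConv (L →ₗ[k] k)) :=
    e.dualBasis.map (WithConv.linearEquiv k (L →ₗ[k] k)).symm
  let f : Module.End k (WithConv (L →ₗ[k] k)) →ₐ[k] Matrix (Fin n) (Fin n) k :=
    (LinearMap.toMatrixAlgEquiv b).toAlgHom
  have hf : Function.Injective f := (LinearMap.toMatrixAlgEquiv b).injective
  have h := isHeisenberg_comp (isHeisenberg_lmul_dualAction (k := k) (L := L)) f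
  have hρ : Function.Injective (f.comp (dualAction k L)) := hf.comp dualAction_injective
  obtain ⟨E⟩ := (h.solution e).nonempty_bialgEquiv_P _ hρ
    (h.range_eq_P e (hf.comp Algebra.lmul_injective)) (h.comulA_solution e)
  refine ⟨⟨h.solution e, ?_⟩, ⟨E⟩⟩
  rw [PentagonSolution.tensorLength_eq_finrank]
  exact (E : L ≃ₐ[k] _).toLinearEquiv.finrank_eq.symm.trans hn

end Existence

/-! ### Hopf modules and their coinvariants. -/

section HopfModule

variable {k L A ι : Type*} [Field k] [Ring L] [HopfAlgebra k L] [Ring A] [Algebra k A] [Fintype ι]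

/-- `∑ Δ(S(x₁)) (x₂ ⊗ 1) = 1 ⊗ S(x)`. -/
theorem comul_antipode_mul_includeLeft :
    toConv ((comul : L →ₗ[k] L ⊗[k] L) ∘ₗ HopfAlgebra.antipode k) *
        toConv (Algebra.TensorProduct.includeLeft : L →ₐ[k] L ⊗[k] L).toLinearMap =
      toConv ((Algebra.TensorProduct.includeRight : L →ₐ[k] L ⊗[k] L).toLinearMap ∘ₗ
        HopfAlgebra.antipode k) := by
  set i₁ := (Algebra.TensorProduct.includeLeft : L →ₐ[k] L ⊗[k] L)
  set i₂ := (Algebra.TensorProduct.includeRight : L →ₐ[k] L ⊗[k] L)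
  have hδ : toConv i₁.toLinearMap * toConv i₂.toLinearMap =
      toConv (comul : L →ₗ[k] L ⊗[k] L) := by
    ext x
    rw [(ℛ k x).convMul_apply]
    simp [i₁, i₂, (ℛ k x).eq]
  have h (f : L →ₐ[k] L ⊗[k] L) :
      toConv f.toLinearMap * toConv (f.toLinearMap ∘ₗ HopfAlgebra.antipode k) = 1 ∧
        toConv (f.toLinearMap ∘ₗ HopfAlgebra.antipode k) * toConv f.toLinearMap = 1 := by
    have h1 := LinearMap.algHom_comp_convMul_distrib f (toConv (LinearMap.id : L →ₗ[k] L))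
      (toConv (HopfAlgebra.antipode k))
    have h2 := LinearMap.algHom_comp_convMul_distrib f (toConv (HopfAlgebra.antipode k))
      (toConv (LinearMap.id : L →ₗ[k] L))
    rw [LinearMap.id_mul_antipode] at h1
    rw [LinearMap.antipode_mul_id] at h2
    constructor
    · refine (WithConv.ext h1).symm.trans ?_
      ext x
      simp
    · refine (WithConv.ext h2).symm.trans ?_
      ext x
      simp
  -- `Δ ∘ S` is the convolution inverse of `Δ = i₁ * i₂`, so multiplying it by `i₁` on the right
  -- leaves the inverse of `i₂`, namely `i₂ ∘ S`.
  have hS := (h (Bialgebra.comulAlgHom k L)).2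
  change toConv (comul ∘ₗ HopfAlgebra.antipode k) * toConv (comul : L →ₗ[k] L ⊗[k] L) = 1 at hS
  rw [← hδ] at hS
  calc _ = toConv ((comul : L →ₗ[k] L ⊗[k] L) ∘ₗ HopfAlgebra.antipode k) *
        toConv i₁.toLinearMap *
        (toConv i₂.toLinearMap * toConv (i₂.toLinearMap ∘ₗ HopfAlgebra.antipode k)) := by
        rw [(h i₂).1, mul_one]
    _ = _ := by
        rw [← mul_assoc, mul_assoc (toConv (comul ∘ₗ HopfAlgebra.antipode k)), hS, one_mul]

/-- The element `∑ aᵢ ⊗ bᵢ` defines a left coaction that makes every `A`-module a Hopf module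
over `L`, which acts through `π`. -/
structure IsHopfCoaction (π : L →ₐ[k] A) (a : ι → L) (b : ι → A) : Prop where
  comul_eq : ∑ i, (comul (a i) : L ⊗[k] L) ⊗ₜ[k] b i =
    ∑ i, ∑ j, (a i ⊗ₜ[k] a j) ⊗ₜ[k] (b j * b i)
  counit_eq : ∑ i, counit (R := k) (a i) • b i = 1
  compat : ∀ x, (∑ i, a i ⊗ₜ[k] b i) * ((1 : L) ⊗ₜ[k] π x) =
    Algebra.TensorProduct.map (AlgHom.id k L) π (comul x) * ∑ i, a i ⊗ₜ[k] b i

namespace IsHopfCoaction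

variable {π : L →ₐ[k] A} {a : ι → L} {b : ι → A}

/-- The projection `∑ S(aᵢ) bᵢ` onto the coinvariants. -/
def projection (π : L →ₐ[k] A) (a : ι → L) (b : ι → A) : A :=
  ∑ i, π (HopfAlgebra.antipode k (a i)) * b i

/-- Compatibility moves the coaction past `S(aⱼ)` as `Δ(S(aⱼ))`; coassociativity then merges the two
copies of the coaction, and `∑ Δ(S(x₁))(x₂ ⊗ 1) = 1 ⊗ S(x)` collapses the result. -/
theorem mul_projection (h : IsHopfCoaction π a b) :
    (∑ i, a i ⊗ₜ[k] b i) * ((1 : L) ⊗ₜ[k] projection π a b) =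
      (1 : L) ⊗ₜ[k] projection π a b := by
  let θ := Algebra.TensorProduct.map (AlgHom.id k L) π
  let Ψ : (L ⊗[k] L) ⊗[k] A →ₗ[k] L ⊗[k] A :=
    LinearMap.mul' k (L ⊗[k] A) ∘ₗ
      TensorProduct.map (θ.toLinearMap ∘ₗ comul ∘ₗ HopfAlgebra.antipode k) LinearMap.id ∘ₗ
      (TensorProduct.assoc k L L A).toLinearMap
  have hΨ (x y : L) (c : A) : Ψ ((x ⊗ₜ y) ⊗ₜ c) =
      θ (comul (HopfAlgebra.antipode k x)) * y ⊗ₜ c := by simp [Ψ]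
  have hΨc (x : L) (c : A) : Ψ (comul x ⊗ₜ c) = 1 ⊗ₜ (π (HopfAlgebra.antipode k x) * c) := by
    have h1 := congrArg (fun f => θ (f x) * ((1 : L) ⊗ₜ[k] c))
      (comul_antipode_mul_includeLeft (k := k) (L := L))
    simp only [(ℛ k x).convMul_apply] at h1
    rw [← (ℛ k x).eq]
    simp only [TensorProduct.sum_tmul, map_sum, hΨ]
    simpa [θ, Finset.sum_mul, mul_assoc] using h1
  calc _ = ∑ j, θ (comul (HopfAlgebra.antipode k (a j))) * (∑ i, a i ⊗ₜ[k] b i) *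
        ((1 : L) ⊗ₜ[k] b j) := by
        simp only [projection, TensorProduct.tmul_sum, Finset.mul_sum (ι := ι) _ _ (∑ i, a i ⊗ₜ[k] b i)]
        refine Finset.sum_congr rfl fun j _ => ?_
        refine Eq.trans ?_ (congrArg (· * ((1 : L) ⊗ₜ[k] b j)) (h.compat _))
        rw [mul_assoc, Algebra.TensorProduct.tmul_mul_tmul, one_mul]
    _ = Ψ (∑ i, ∑ j, (a i ⊗ₜ[k] a j) ⊗ₜ[k] (b j * b i)) := by
        simp only [map_sum, hΨ]
        refine Finset.sum_congr rfl fun j _ => ?_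
        simp [Finset.mul_sum, Finset.sum_mul, mul_assoc]
    _ = _ := by
        rw [← h.comul_eq]
        simp only [map_sum, hΨc, projection, TensorProduct.tmul_sum]

/-- Apply `x ⊗ y ↦ x S(y)` to coassociativity and use the counit. The identity shows that the
projection is nonzero. -/
theorem sum_projection (h : IsHopfCoaction π a b) :
    ∑ i, π (a i) * projection π a b * b i = 1 := by
  let Ψ : (L ⊗[k] L) ⊗[k] A →ₗ[k] A :=
    LinearMap.mul' k A ∘ₗ TensorProduct.map
      (π.toLinearMap ∘ₗ LinearMap.mul' k L ∘ₗ (HopfAlgebra.antipode k).lTensor L) LinearMap.id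
  have h1 := congrArg Ψ h.comul_eq
  simp [Ψ, HopfAlgebra.mul_antipode_lTensor_comul_apply] at h1
  rw [← h.counit_eq]
  simp only [Algebra.smul_def]
  rw [h1]
  simp [projection, Finset.mul_sum, Finset.sum_mul, mul_assoc]

theorem projection_ne_zero [Nontrivial A] (h : IsHopfCoaction π a b) :
    projection π a b ≠ 0 := by
  intro h0
  have := h.sum_projection
  simp [h0] at this

/-- The annihilator in `L` of a nonzero coinvariant is zero. -/
theorem eq_zero_of_mul_eq_zero (h : IsHopfCoaction π a b) {c : A} (hc : c ≠ 0)
    (hinv : (∑ i, a i ⊗ₜ[k] b i) * ((1 : L) ⊗ₜ[k] c) = (1 : L) ⊗ₜ[k] c) {x : L}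
    (hx : π x * c = 0) : x = 0 := by
  let Θ : L →ₗ[k] A := LinearMap.mulRight k c ∘ₗ π.toLinearMap
  have hΘ (z : L ⊗[k] L) : Algebra.TensorProduct.map (AlgHom.id k L) π z * ((1 : L) ⊗ₜ[k] c) =
      Θ.lTensor L z := by
    induction z with
    | zero => simp
    | add x y hx hy => simp only [map_add, add_mul, hx, hy]
    | tmul a b => simp [Θ]
  -- The coaction sends `y c` to `Δ(y)(1 ⊗ c)`, so `Δ` maps the annihilator `N` of `c` into `L ⊗ N`.
  have hcomul {y : L} (hy : Θ y = 0) : Θ.lTensor L (comul y) = 0 := by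
    have hy' : π y * c = 0 := hy
    have := congrArg (· * ((1 : L) ⊗ₜ[k] c)) (h.compat y)
    simp only [mul_assoc] at this
    rw [hinv, hΘ, Algebra.TensorProduct.tmul_mul_tmul, hy'] at this
    simpa using this.symm
  -- `∑ S(y₁) y₂ c = ε(y) c` vanishes although `c ≠ 0`.
  have hcounit {y : L} (hy : Θ y = 0) : counit (R := k) y = 0 := by
    let Ψ : L ⊗[k] A →ₗ[k] A := LinearMap.mul' k A ∘ₗ
      (π.toLinearMap ∘ₗ HopfAlgebra.antipode k).rTensor A
    have h1 (z : L ⊗[k] L) : Ψ (Θ.lTensor L z) =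
        Θ (LinearMap.mul' k L ((HopfAlgebra.antipode k).rTensor L z)) := by
      induction z with
      | zero => simp
      | add x y hx hy => simp only [map_add, hx, hy]
      | tmul a b => simp [Ψ, Θ, mul_assoc]
    have h2 := h1 (comul y)
    rw [hcomul hy, HopfAlgebra.mul_antipode_rTensor_comul_apply, map_zero] at h2
    have h3 : counit (R := k) y • c = 0 := by
      simpa [Θ, Algebra.smul_def] using h2.symm
    exact (smul_eq_zero.1 h3).resolve_right hc
  rw [← Module.forall_dual_apply_eq_zero_iff k]
  intro ξ
  have h1 (z : L ⊗[k] L) : Θ (sliceR ξ z) = sliceR ξ (Θ.lTensor L z) := by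
    induction z with
    | zero => simp
    | add x y hx hy => simp only [map_add, hx, hy]
    | tmul a b => simp
  -- The slice `∑ ξ(x₁) x₂` again annihilates `c`, and its counit is `ξ(x)`.
  have h2 := hcounit (y := sliceR ξ (comul x)) (by rw [h1, hcomul hx, map_zero])
  have h3 (z : L ⊗[k] L) : counit (R := k) (sliceR ξ z) =
      ξ (TensorProduct.rid k L (counit.lTensor L z)) := by
    induction z with
    | zero => simp
    | add x y hx hy => simp only [map_add, hx, hy]
    | tmul a b => simp [mul_comm]
  rw [h3] at h2
  simpa using h2

end IsHopfCoaction

/-- A Hopf module structure on `kⁿ` has a coinvariant `w` such that `x ↦ x w` is injective. -/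
theorem IsHopfCoaction.exists_coinvariant {n : ℕ} [NeZero n] {π : L →ₐ[k] Matrix (Fin n) (Fin n) k}
    {a : ι → L} {b : ι → Matrix (Fin n) (Fin n) k} (h : IsHopfCoaction π a b) :
    ∃ w : Fin n → k, (∑ i, a i ⊗ₜ[k] (b i).mulVec w = (1 : L) ⊗ₜ[k] w) ∧
      Function.Injective fun x => (π x).mulVec w := by
  obtain ⟨v, hv⟩ : ∃ v, (projection π a b).mulVec v ≠ 0 := by
    by_contra! hcon
    exact h.projection_ne_zero (Matrix.ext_of_mulVec_single fun i => by
      rw [hcon, Matrix.zero_mulVec])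
  set w := (projection π a b).mulVec v with hw
  have hcol (x : Matrix (Fin n) (Fin n) k) (u : Fin n → k) :
      x * Matrix.vecMulVec u v = Matrix.vecMulVec (x.mulVec u) v := Matrix.mul_vecMulVec _ _ _
  have hv0 : v ≠ 0 := by
    rintro rfl
    exact hv (Matrix.mulVec_zero _)
  have hinj {u : Fin n → k} (hu : Matrix.vecMulVec u v = 0) : u = 0 := by
    by_contra h0
    obtain ⟨i, hi⟩ := Function.ne_iff.1 h0
    obtain ⟨j, hj⟩ := Function.ne_iff.1 hv0
    exact mul_ne_zero hi hj (congrFun (congrFun hu i) j)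
  -- The rank-one matrix `w vᵀ` stands in for the vector `w`, so that the annihilator lemma, stated
  -- inside the algebra, applies.
  have hc : Matrix.vecMulVec w v ≠ 0 := fun h0 => hv (hinj h0)
  have hinv := congrArg (· * ((1 : L) ⊗ₜ[k] Matrix.vecMulVec v v)) h.mul_projection
  simp only [mul_assoc, Algebra.TensorProduct.tmul_mul_tmul, one_mul, hcol, ← hw] at hinv
  refine ⟨w, ?_, ?_⟩
  · have := congrArg (LinearMap.lTensor L (Matrix.mulVecBilin k k |>.flip v)) h.mul_projection
    simpa [Finset.sum_mul, ← Matrix.mulVec_mulVec, ← hw] using this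
  · intro x y hxy
    refine sub_eq_zero.1 (h.eq_zero_of_mul_eq_zero hc hinv ?_)
    rw [hcol, map_sub, Matrix.sub_mulVec, sub_eq_zero.2 hxy, Matrix.zero_vecMulVec]

/-- Under `x ↦ x w`, the coaction on `kⁿ` corresponds to the comultiplication of `L`, because `w` is
coinvariant. -/
theorem IsHopfCoaction.sum_tmul_mulVec {n : ℕ} {π : L →ₐ[k] Matrix (Fin n) (Fin n) k}
    {a : ι → L} {b : ι → Matrix (Fin n) (Fin n) k} (h : IsHopfCoaction π a b) {w : Fin n → k}
    (hw : ∑ i, a i ⊗ₜ[k] (b i).mulVec w = (1 : L) ⊗ₜ[k] w) (x : L) :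
    ∑ i, a i ⊗ₜ[k] (b i).mulVec ((π x).mulVec w) =
      ((Matrix.mulVecBilin k k).flip w ∘ₗ π.toLinearMap).lTensor L (comul x) := by
  have h1 := congrArg (LinearMap.lTensor L ((Matrix.mulVecBilin k k).flip w)) (h.compat x)
  have h2 (z : L ⊗[k] L) : LinearMap.lTensor L ((Matrix.mulVecBilin k k).flip w)
      (Algebra.TensorProduct.map (AlgHom.id k L) π z * ∑ i, a i ⊗ₜ[k] b i) =
      ((Matrix.mulVecBilin k k).flip w ∘ₗ π.toLinearMap).lTensor L z := by
    induction z with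
    | zero => simp
    | add x y hx hy => simp only [map_add, add_mul, hx, hy]
    | tmul c d =>
      have := congrArg (TensorProduct.map (LinearMap.mulLeft k c) (π d).mulVecLin) hw
      simpa [Finset.mul_sum] using this
  rw [h2] at h1
  rw [← h1]
  simp [Finset.sum_mul]

end HopfModule

/-! ### The coaction given by the inverse of a solution. -/

namespace PentagonSolution

section Coaction

variable {k A : Type*} [Field k] [Ring A] [Algebra k A]

/-- `Δ ⊗ id` is an algebra map sending `R` to `R¹³R²³`, so it sends `R⁻¹` to the inverse of that
product. -/
theorem rTensor_comulA_inv (R : PentagonSolution k A) :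
    R.comulA.toLinearMap.rTensor A R.inv =
      (Algebra.TensorProduct.assoc k k k A A A).symm (leg23 R.inv * leg13 R.inv) := by
  let G : A ⊗[k] A →ₐ[k] (A ⊗[k] A) ⊗[k] A :=
    Algebra.TensorProduct.map R.comulA (AlgHom.id k A)
  let α := (Algebra.TensorProduct.assoc k k k A A A).symm
  have h1 : G R.val = α (leg13 R.val * leg23 R.val) := by
    rw [leg13_mul_leg23, leg12_leg23_leg12]
    rfl
  refine left_inv_eq_right_inv (a := G R.val) (b := G R.inv) ?_ ?_
  · rw [← map_mul, R.inv_mul_val, map_one]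
  · change G R.val * α (leg23 R.inv * leg13 R.inv) = 1
    rw [h1, ← map_mul, mul_assoc, ← mul_assoc (leg23 R.val), ← map_mul, R.val_mul_inv, map_one,
      one_mul, ← map_mul, R.val_mul_inv, map_one, map_one]

variable [FiniteDimensional k A] {ι : Type*} [Fintype ι]

/-- The left coefficients of `R⁻¹` with respect to a basis, as elements of `P(A, R)`. -/
def invCoeff (R : PentagonSolution k A) (e : Module.Basis ι k A) (i : ι) : R.P :=
  R.antipodeP ⟨sliceL (e.coord i) R.val, sliceL_mem _ _⟩

theorem sum_invCoeff (R : PentagonSolution k A) (e : Module.Basis ι k A) :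
    ∑ i, (R.invCoeff e i : A) ⊗ₜ[k] e i = R.inv := by
  rw [eq_sum_sliceL e R.inv]
  exact Finset.sum_congr rfl fun i _ => by rw [invCoeff, antipodeP_sliceL]

/-- Each axiom is an identity for `R⁻¹`: its image under `Δ ⊗ id`, the equality `ε ∘ S = ε`, and
`R⁻¹(1 ⊗ x) = Δ(x)R⁻¹`. The first and last are checked after embedding `P` into `A`. -/
theorem isHopfCoaction_invCoeff [Nontrivial A] (R : PentagonSolution k A)
    (e : Module.Basis ι k A) : IsHopfCoaction R.P.val (R.invCoeff e) e where
  comul_eq := by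
    have hinj : Function.Injective (Algebra.TensorProduct.map R.inclTwo (AlgHom.id k A)) :=
      TensorProduct.map_injective_of_flat_flat R.inclTwo.toLinearMap LinearMap.id
        R.inclTwo_injective Function.injective_id
    apply hinj
    have h := R.rTensor_comulA_inv
    rw [← R.sum_invCoeff e] at h
    simp only [map_sum, LinearMap.rTensor_tmul, Finset.sum_mul_sum, leg13_tmul, leg23_apply,
      map_mul] at h
    simp only [map_sum, Algebra.TensorProduct.map_tmul]
    refine Eq.trans (Finset.sum_congr rfl fun i _ => ?_) (h.trans ?_)
    · exact congrArg (· ⊗ₜ[k] e i) (R.inclTwo_comulP' _)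
    · rw [Finset.sum_comm]
      simp [inclTwo]
  counit_eq := by
    refine Eq.trans (Finset.sum_congr rfl fun i _ => ?_) (R.sum_counitA_left e)
    exact congrArg (· • e i)
      (HopfAlgebra.counit_antipode (⟨sliceL (e.coord i) R.val, sliceL_mem _ _⟩ : R.P))
  compat x := by
    have hinj : Function.Injective (Algebra.TensorProduct.map R.P.val (AlgHom.id k A)) :=
      TensorProduct.map_injective_of_flat_flat R.P.val.toLinearMap LinearMap.id
        Subtype.val_injective Function.injective_id
    apply hinj
    have h1 : Algebra.TensorProduct.map R.P.val (AlgHom.id k A)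
        (∑ i, R.invCoeff e i ⊗ₜ[k] e i) = R.inv := by
      rw [← R.sum_invCoeff e]
      simp
    have h2 (z : R.P ⊗[k] R.P) : Algebra.TensorProduct.map R.P.val (AlgHom.id k A)
        (Algebra.TensorProduct.map (AlgHom.id k R.P) R.P.val z) = R.inclTwo z := by
      induction z with
      | zero => simp
      | add x y hx hy => simp only [map_add, hx, hy]
      | tmul a b => simp [inclTwo]
    rw [map_mul, map_mul, h1, h2]
    refine Eq.trans ?_ (congrArg (· * R.inv) (R.inclTwo_comulP x).symm)
    simp [mul_assoc, R.val_mul_inv]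

end Coaction

end PentagonSolution

/-! ### Isomorphic Hopf algebras come from conjugate solutions. -/

section Uniqueness

variable {k : Type*} [Field k] {n : ℕ}

/-- Each matrix entry is a coordinate of the action on a standard basis vector. -/
theorem tensor_matrix_ext {L : Type*} [Ring L] [Algebra k L]
    {X Y : L ⊗[k] Matrix (Fin n) (Fin n) k}
    (h : ∀ v : Fin n → k, ((Matrix.mulVecBilin k k).flip v).lTensor L X =
      ((Matrix.mulVecBilin k k).flip v).lTensor L Y) : X = Y := by
  rw [eq_sum_sliceL (Matrix.stdBasis k (Fin n) (Fin n)) X,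
    eq_sum_sliceL (Matrix.stdBasis k (Fin n) (Fin n)) Y]
  refine Finset.sum_congr rfl fun p _ => ?_
  have key (Z : L ⊗[k] Matrix (Fin n) (Fin n) k) :
      sliceL ((Matrix.stdBasis k (Fin n) (Fin n)).coord p) Z =
        TensorProduct.rid k L ((LinearMap.proj (R := k) (φ := fun _ : Fin n => k) p.1).lTensor L
          (((Matrix.mulVecBilin k k).flip (Pi.single p.2 1)).lTensor L Z)) := by
    have : (Matrix.stdBasis k (Fin n) (Fin n)).coord p =
        LinearMap.proj (R := k) (φ := fun _ : Fin n => k) p.1 ∘ₗ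
          (Matrix.mulVecBilin k k).flip (Pi.single p.2 1) := by
      refine (Matrix.stdBasis k (Fin n) (Fin n)).ext fun q => ?_
      obtain ⟨i, j⟩ := q
      obtain ⟨i', j'⟩ := p
      rw [Module.Basis.coord_apply, Module.Basis.repr_self, Matrix.stdBasis_eq_single]
      simp [Finsupp.single_apply, Matrix.single_apply]
    rw [this, ← LinearMap.comp_apply (LinearMap.lTensor _ _), ← LinearMap.lTensor_comp]
    rfl
  rw [key, key, h]

theorem PentagonSolution.exists_smul_eq [NeZero n]
    (R R' : PentagonSolution k (Matrix (Fin n) (Fin n) k))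
    (hR : Module.finrank k R.P = n) (hR' : Module.finrank k R'.P = n) (f : R.P ≃ₐc[k] R'.P) :
    ∃ u : Matrix.GeneralLinearGroup (Fin n) k, u • R = R' := by
  let e := Module.finBasis k (Matrix (Fin n) (Fin n) k)
  let T (v : Fin n → k) : Matrix (Fin n) (Fin n) k →ₗ[k] (Fin n → k) :=
    (Matrix.mulVecBilin k k).flip v
  have hc := R.isHopfCoaction_invCoeff e
  have hc' := R'.isHopfCoaction_invCoeff e
  obtain ⟨w, hw, hinj⟩ := hc.exists_coinvariant
  obtain ⟨w', hw', hinj'⟩ := hc'.exists_coinvariant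
  let φ : R.P ≃ₗ[k] (Fin n → k) :=
    LinearMap.linearEquivOfInjective (T w ∘ₗ R.P.val.toLinearMap) hinj (by simp [hR])
  let φ' : R'.P ≃ₗ[k] (Fin n → k) :=
    LinearMap.linearEquivOfInjective (T w' ∘ₗ R'.P.val.toLinearMap) hinj' (by simp [hR'])
  have hφ (x : R.P) : φ x = (x : Matrix (Fin n) (Fin n) k).mulVec w := rfl
  have hφ' (x : R'.P) : φ' x = (x : Matrix (Fin n) (Fin n) k).mulVec w' := rfl
  -- `g` sends `x w` to `f(x) w'`: it is `f` read through the identifications of `kⁿ` with the two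
  -- Hopf algebras.
  let g : (Fin n → k) ≃ₗ[k] (Fin n → k) :=
    φ.symm ≪≫ₗ (f : R.P ≃ₐ[k] R'.P).toLinearEquiv ≪≫ₗ φ'
  let u : Matrix.GeneralLinearGroup (Fin n) k :=
    ⟨LinearMap.toMatrix' g.toLinearMap, LinearMap.toMatrix' g.symm.toLinearMap,
      by rw [← LinearMap.toMatrix'_comp]; simp, by rw [← LinearMap.toMatrix'_comp]; simp⟩
  have hu (v : Fin n → k) : u.val.mulVec v = g v := LinearMap.toMatrix'_mulVec _ _
  have hg (x : R.P) : g (φ x) = φ' (f x) := by simp [g]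
  have hcomm (x : R.P) : innerHom k u x = f x := by
    have h1 : u.val * (x : Matrix (Fin n) (Fin n) k) = (f x : Matrix (Fin n) (Fin n) k) * u.val := by
      refine Matrix.ext_of_mulVec_single fun i => ?_
      obtain ⟨y, hy⟩ := φ.surjective (Pi.single i 1)
      rw [← hy, ← Matrix.mulVec_mulVec, ← Matrix.mulVec_mulVec, hu (φ y), hg, hφ, hφ',
        Matrix.mulVec_mulVec, Matrix.mulVec_mulVec]
      have h2 := hg (x * y)
      rw [hφ, hφ', map_mul, ← hu, Subalgebra.coe_mul, Subalgebra.coe_mul, Matrix.mulVec_mulVec,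
        ← mul_assoc] at h2
      simpa only [Matrix.mulVec_mulVec] using h2
    change u.val * x * (u⁻¹).val = _
    rw [h1, mul_assoc, Units.mul_inv, mul_one]
  -- `g` also intertwines the coactions, since both correspond to comultiplications and `f` respects
  -- these.
  have key : TensorProduct.map (f : R.P ≃ₐ[k] R'.P).toLinearMap (innerHom k u).toLinearMap
      (∑ i, R.invCoeff e i ⊗ₜ[k] e i) = ∑ i, R'.invCoeff e i ⊗ₜ[k] e i := by
    refine tensor_matrix_ext fun v => ?_
    obtain ⟨y', rfl⟩ := φ'.surjective v
    obtain ⟨y, rfl⟩ := f.surjective y'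
    have h1 := hc'.sum_tmul_mulVec hw' (f y)
    have h2 := hc.sum_tmul_mulVec hw y
    have h3 := congrArg (TensorProduct.map (f : R.P ≃ₐ[k] R'.P).toLinearMap g.toLinearMap) h2
    have h4 (z : R.P ⊗[k] R.P) :
        TensorProduct.map (f : R.P ≃ₐ[k] R'.P).toLinearMap g.toLinearMap
          ((T w ∘ₗ R.P.val.toLinearMap).lTensor R.P z) =
        (T w' ∘ₗ R'.P.val.toLinearMap).lTensor R'.P
          (TensorProduct.map (f : R.P →ₗc[k] R'.P).toLinearMap
            (f : R.P →ₗc[k] R'.P).toLinearMap z) := by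
      induction z with
      | zero => simp
      | add x y hx hy => simp only [map_add, hx, hy]
      | tmul a b => exact congrArg ((f a) ⊗ₜ[k] ·) (hg b)
    have h5 := LinearMap.congr_fun (f : R.P →ₗc[k] R'.P).map_comp_comul y
    have h6 (b : Matrix (Fin n) (Fin n) k) :
        (innerHom k u b).mulVec (φ' (f y)) = g (b.mulVec (φ y)) := by
      rw [← hg, ← hu, ← hu]
      change (u.val * b * (u⁻¹).val).mulVec _ = _
      rw [Matrix.mulVec_mulVec, Matrix.mulVec_mulVec, mul_assoc, Units.inv_mul, mul_one]
    refine Eq.trans ?_ (h3.trans ((h4 _).trans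
      ((congrArg ((T w' ∘ₗ R'.P.val.toLinearMap).lTensor R'.P) h5).trans (h1.symm.trans ?_))))
    · simp only [map_sum, TensorProduct.map_tmul, LinearMap.lTensor_tmul]
      exact Finset.sum_congr rfl fun i _ => congrArg (f (R.invCoeff e i) ⊗ₜ[k] ·) (h6 (e i))
    · simp only [map_sum, LinearMap.lTensor_tmul]
      rfl
  have hinv : (u • R).inv = R'.inv := by
    rw [inv_smul_val, ← R.sum_invCoeff e, ← R'.sum_invCoeff e]
    have h1 := congrArg (R'.P.val.toLinearMap.rTensor (Matrix (Fin n) (Fin n) k)) key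
    simp only [map_sum, TensorProduct.map_tmul, LinearMap.rTensor_tmul] at h1
    simp only [map_sum, Algebra.TensorProduct.map_tmul, hcomm]
    exact h1
  refine ⟨u, PentagonSolution.ext ?_⟩
  refine left_inv_eq_right_inv (u • R).val_mul_inv ?_
  rw [hinv, R'.inv_mul_val]

end Uniqueness

/-! ### The bijection between orbits and isomorphism types. -/

theorem Pent.finrank_hopf {k : Type*} [Field k] {n : ℕ} (R : Pent k n) :
    Module.finrank k R.hopf = n :=
  R.1.tensorLength_eq_finrank.symm.trans R.2

end

end PentagonHopf

theorem mainTheorem1 (k : Type*) [Field k] (n : ℕ) [NeZero n] :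
    (∃ Φ : PentagonHopf.PentOrbits k n ≃ PentagonHopf.HopfTypes k n,
      ∀ R : PentagonHopf.Pent k n, ∃ h : Module.finrank k R.hopf = n,
        Φ R.orbit = PentagonHopf.HopfTypes.mk R.hopf h) ∧
    (∀ (L : Type*) [Ring L] [HopfAlgebra k L], Module.finrank k L = n →
      ∃ R : PentagonHopf.Pent k n, Nonempty (L ≃ₐc[k] R.hopf)) := by
  refine ⟨?_, fun L _ _ h => PentagonHopf.exists_pent_bialgEquiv k n L h⟩
  let F : PentagonHopf.PentOrbits k n → PentagonHopf.HopfTypes k n :=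
    Quotient.lift (fun R => PentagonHopf.HopfTypes.mk R.hopf R.finrank_hopf) (by
      rintro _ R ⟨u, rfl⟩
      obtain ⟨E⟩ := R.1.nonempty_bialgEquiv_P_smul u
      exact Quotient.sound ⟨E.symm⟩)
  have hF : Function.Bijective F := by
    constructor
    · rintro ⟨R⟩ ⟨R'⟩ h
      obtain ⟨E⟩ := Quotient.exact h
      -- The orbit relation asks for `u • R' = R`, hence the reversed isomorphism.
      obtain ⟨u, hu⟩ := R'.1.exists_smul_eq R.1 R'.finrank_hopf R.finrank_hopf E.symm
      exact Quotient.sound ⟨u, Subtype.ext hu⟩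
    · rintro ⟨L, hL⟩
      obtain ⟨R, ⟨E⟩⟩ := PentagonHopf.exists_pent_bialgEquiv k n L hL
      exact ⟨R.orbit, Quotient.sound ⟨E.symm⟩⟩
  exact ⟨Equiv.ofBijective F hF, fun R => ⟨R.finrank_hopf, rfl⟩⟩
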